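/- Let $\mathbb D=\{z\in\mathbb C:|z|<1\}$ and let $K\subset\mathbb D$ be a compact set. For integers $j\ge 0$ put \[ K_j:=\bigl\{z\in\mathbb C:\operatorname{dist}(z,K)\le 2^{-(j+1)}\operatorname{dist}(K,\partial\mathbb D)\bigr\} \] (with $K_j=\emptyset$ if $K=\emptyset$), and for integers $j\ge -1$ put $D_j:=\{z\in\mathbb C:|z-3j|<1\}$. Then there is a transcendental meromorphic function $f\colon\mathbb C\to\mathbb C\cup\{\infty\}$ (that is, $f$ is meromorphic in $\mathbb C$ and is not a rational function) with the following properties, where $f^n$ denotes the $n$-th iterate of $f$, defined at those points whose first $n-1$ iterates are finite, and $f^0=\mathrm{id}$: (a) $f(\overline{D_{-1}})\subseteq D_{-1}$. (b) For every $j\ge 0$, the iterate $f^j$ is defined and injective on $K_j$, and $f^j(K_j)\subseteq D_j$. (c) For every $j\ge 0$, the iterate $f^{j+1}$ is defined on $\partial K_j$, and $f^{j+1}(\partial K_j)\subseteq D_{-1}$. -/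

import Mathlib

open scoped Topology OnePoint Polynomial

noncomputable section

namespace WanderingCompacta

/-- A function `f : ℂ → ℂ ∪ {∞}` is meromorphic in the plane: near each point (the point itself
excepted) it coincides with a finite-valued function that is meromorphic at the point, and it takes
at the point the value that makes it continuous into the Riemann sphere. So `f z = ∞` exactly at
the poles, poles are isolated, and the constant `∞` is not meromorphic. -/
def IsMeromorphic (f : ℂ → OnePoint ℂ) : Prop :=
  Continuous f ∧
    ∀ z : ℂ, ∃ g : ℂ → ℂ, MeromorphicAt g z ∧ ∀ᶠ w in 𝓝[≠] z, f w = ((g w : ℂ) : OnePoint ℂ)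

/-- `f` is (the restriction to the plane of) a rational function `p / q`. -/
def IsRational (f : ℂ → OnePoint ℂ) : Prop :=
  ∃ p q : ℂ[X], q ≠ 0 ∧
    ∀ z : ℂ, q.eval z ≠ 0 → f z = ((p.eval z / q.eval z : ℂ) : OnePoint ℂ)

/-- A transcendental meromorphic function: meromorphic in the plane and not rational. -/
def IsTranscendentalMeromorphic (f : ℂ → OnePoint ℂ) : Prop :=
  IsMeromorphic f ∧ ¬ IsRational f

/-- The `n`-th iterate of `f : ℂ → ℂ ∪ {∞}`. Where an earlier iterate takes the value `∞`, the
iterate is not defined in the usual sense; it then has the value `∞` here. In particular a finite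
value is always a genuine one, see `iter_ne_infty`. -/
def iter (f : ℂ → OnePoint ℂ) : ℕ → ℂ → OnePoint ℂ
  | 0, z => (z : OnePoint ℂ)
  | n + 1, z => (iter f n z).elim ∞ f

/-- If the `n`-th iterate is finite at `z`, then so are all the earlier ones. -/
theorem iter_ne_infty {f : ℂ → OnePoint ℂ} {n : ℕ} {z : ℂ} (h : iter f n z ≠ ∞) :
    ∀ k ≤ n, iter f k z ≠ ∞ := by
  induction n with
  | zero =>
    intro k hk
    obtain rfl : k = 0 := by omega
    exact h
  | succ n ih =>
    intro k hk
    rcases Nat.lt_or_ge n k with hlt | hge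
    · obtain rfl : k = n + 1 := by omega
      exact h
    · refine ih (fun h0 => h ?_) k hge
      simp [iter, h0]

/-- The distance `inf {|x - y| : x ∈ A, y ∈ B}` between two (non-empty) sets. -/
def setDist (A B : Set ℂ) : ℝ := sInf (Set.image2 dist A B)

/-- The closed neighbourhood `K_j` of `K`, the set of all `z` with
`dist(z, K) ≤ 2 ^ (-(j + 1)) * dist(K, ∂𝔻)`. It is empty if `K` is empty. -/
def nbhd (K : Set ℂ) (j : ℕ) : Set ℂ :=
  Metric.cthickening ((1 / 2 : ℝ) ^ (j + 1) * setDist K (frontier (Metric.ball (0 : ℂ) 1))) K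

/-- The open disc `D_j` of radius `1` about `3 j`. -/
def disc (j : ℤ) : Set ℂ := Metric.ball (3 * (j : ℂ)) 1

end WanderingCompacta

end

open MeasureTheory Set Filter Metric

/-! The function is `f = -3 + ∑ r k`, where the block `r k` is meromorphic and tiny off the disc of
radius 3/2 about `3k`. Off all these discs `f` is within 1 of -3, which gives (a). In `D_n` the
block `r n` is close to `z + 6` near the `n`-th image of `K_{n+1}` and small near the `n`-th image
of `∂K_n`, so there `f` is nearly the translation `z + 3`, respectively nearly -3. These two images
are disjoint compacta because the `n`-th iterate is injective on `K_n`; a Runge argument then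
supplies the block (`exists_meromorphic_separating`, `exists_meromorphic_block`).

The choice of `r n` precedes that of the later blocks, so it is adapted to the iterates of the
partial sum of the earlier ones, with a margin `η n` that later perturbations must not exceed. The
central induction `hasIterate` treats every `F` close to the partial sums: applied to a partial sum
it justifies the choice of the next block (`isCloseBlock`), applied to `f` it gives (b) and (c). Two
estimates carry it. Blocks decay like `(1 + |z|)⁻²`, so the deviation of the iterates from
translations is summable and stays below `ρ`. By the Schwarz lemma `F w - F z` differs from `w - z`
by at most a quarter of `|w - z|`, so injectivity persists and errors at most double per step, up to
the new perturbation.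

Finally `f` is bounded along `3n + 3/2` but unbounded along an orbit starting in `K`, so it is not
rational. -/

namespace WanderingCompacta

/-! ### The Cauchy–Pompeiu formula -/

/-- The **Cauchy–Pompeiu formula** for compactly supported functions. -/
theorem integral_dbar_div_sub {φ : ℂ → ℂ} (hφ : ContDiff ℝ 1 φ) (hc : HasCompactSupport φ)
    (z : ℂ) :
    ∫ ζ, (fderiv ℝ φ ζ 1 + Complex.I * fderiv ℝ φ ζ Complex.I) / (ζ - z)
      = -(2 * Real.pi) * φ z := by
  have hD : Continuous (fderiv ℝ φ) := hφ.continuous_fderiv (by norm_num)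
  have hDc : HasCompactSupport (fderiv ℝ φ) := hc.fderiv ℝ
  obtain ⟨R, hR⟩ := hDc.isBounded.subset_closedBall z
  have hout : ∀ r θ : ℝ, 0 < r → R < r →
      fderiv ℝ φ (z + r * Complex.exp (θ * Complex.I)) = 0 := by
    intro r θ h0 h
    by_contra hne
    have := hR (subset_tsupport _ hne)
    rw [mem_closedBall, dist_eq_norm, add_sub_cancel_left, norm_mul,
      Complex.norm_exp_ofReal_mul_I, mul_one, Complex.norm_real, Real.norm_of_nonneg h0.le] at this
    linarith
  set e : ℝ → ℂ := fun θ => Complex.exp (θ * Complex.I) with he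
  have hec : Continuous e := by fun_prop
  -- In polar coordinates about `z` the Jacobian cancels the modulus of the kernel and leaves `A +
  -- B`. Here `A` is the radial derivative, whose integral along each ray is `-φ z`, and `B` is `I /
  -- r` times the angular derivative, whose integral over each circle is zero.
  set A : ℝ × ℝ → ℂ := fun p => fderiv ℝ φ (z + p.1 * e p.2) (e p.2) with hA
  set B : ℝ × ℝ → ℂ :=
    fun p => Complex.I * fderiv ℝ φ (z + p.1 * e p.2) (Complex.I * e p.2) with hB
  have hDp : Continuous fun p : ℝ × ℝ => fderiv ℝ φ (z + p.1 * e p.2) :=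
    hD.comp (by fun_prop)
  have hAc : Continuous A := hDp.clm_apply (by fun_prop)
  have hBc : Continuous B := continuous_const.mul (hDp.clm_apply (by fun_prop))
  have hint : ∀ C : ℝ × ℝ → ℂ, Continuous C →
      (∀ p : ℝ × ℝ, 0 < p.1 → R < p.1 → C p = 0) →
      IntegrableOn C (Ioi (0 : ℝ) ×ˢ Ioo (-Real.pi) Real.pi) := by
    intro C hC h0
    have h1 : IntegrableOn C (Icc (0 : ℝ) R ×ˢ Icc (-Real.pi) Real.pi) :=
      hC.continuousOn.integrableOn_compact (isCompact_Icc.prod isCompact_Icc)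
    refine h1.of_forall_sdiff_eq_zero (measurableSet_Ioi.prod measurableSet_Ioo) ?_
    rintro ⟨r, θ⟩ ⟨⟨hr, hθ⟩, hn⟩
    refine h0 _ hr ?_
    by_contra hle
    exact hn ⟨⟨(mem_Ioi.1 hr).le, not_lt.1 hle⟩, Ioo_subset_Icc_self hθ⟩
  have hAi := hint A hAc fun p h h' => by simp [hA, he, hout p.1 p.2 h h']
  have hBi := hint B hBc fun p h h' => by simp [hB, he, hout p.1 p.2 h h']
  have hIA : ∫ p in Ioi (0 : ℝ) ×ˢ Ioo (-Real.pi) Real.pi, A p = -(2 * Real.pi) * φ z := by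
    rw [IntegrableOn, Measure.volume_eq_prod, ← Measure.prod_restrict] at hAi
    rw [Measure.volume_eq_prod, ← Measure.prod_restrict, integral_prod_symm _ hAi]
    have hinner : ∀ θ : ℝ, ∫ r in Ioi (0 : ℝ), A (r, θ) = -φ z := by
      intro θ
      have hne : ∀ r : ℝ, HasDerivAt (fun r : ℝ => z + r * e θ) (e θ) r := by
        intro r
        simpa using ((Complex.ofRealCLM.hasDerivAt (x := r)).mul_const (e θ)).const_add z
      have hd : ∀ r : ℝ, HasDerivAt (fun r : ℝ => φ (z + r * e θ)) (A (r, θ)) r := fun r =>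
        ((hφ.differentiable (by norm_num)) (z + r * e θ)).hasFDerivAt.comp_hasDerivAt r (hne r)
      have hcs : HasCompactSupport fun r : ℝ => φ (z + r * e θ) := by
        refine hc.comp_isClosedEmbedding (g := fun r : ℝ => z + r * e θ) ?_
        refine Isometry.isClosedEmbedding (Isometry.of_dist_eq fun a b => ?_)
        rw [dist_add_left, dist_eq_norm, ← sub_mul, norm_mul, he,
          Complex.norm_exp_ofReal_mul_I, mul_one, ← Complex.ofReal_sub, Complex.norm_real]
        rfl
      have := HasCompactSupport.integral_Ioi_deriv_eq (f := fun r : ℝ => φ (z + r * e θ))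
        (hφ.comp (contDiff_const.add (Complex.ofRealCLM.contDiff.mul contDiff_const))) hcs 0
      simp only [(hd _).deriv] at this
      simpa using this
    simp only [hinner]
    rw [integral_const, measureReal_restrict_apply_univ, Real.volume_real_Ioo_of_le
      (by linarith [Real.pi_pos]), Complex.real_smul]
    push_cast
    ring
  have hIB : ∫ p in Ioi (0 : ℝ) ×ˢ Ioo (-Real.pi) Real.pi, B p = 0 := by
    rw [IntegrableOn, Measure.volume_eq_prod, ← Measure.prod_restrict] at hBi
    rw [Measure.volume_eq_prod, ← Measure.prod_restrict, integral_prod _ hBi]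
    refine setIntegral_eq_zero_of_forall_eq_zero fun r hr => ?_
    have hr0 : (r : ℂ) ≠ 0 := by exact_mod_cast (mem_Ioi.1 hr).ne'
    have hne : ∀ θ : ℝ, HasDerivAt (fun θ : ℝ => z + r * e θ) (r • (Complex.I * e θ)) θ := by
      intro θ
      have h1 : HasDerivAt (fun θ : ℝ => (θ : ℂ) * Complex.I) Complex.I θ := by
        simpa using (Complex.ofRealCLM.hasDerivAt (x := θ)).mul_const Complex.I
      have h2 := (h1.cexp.const_mul (r : ℂ)).const_add z
      refine h2.congr_deriv ?_
      rw [Complex.real_smul]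
      ring
    have hd : ∀ θ : ℝ, HasDerivAt (fun θ : ℝ => φ (z + r * e θ)) ((r / Complex.I) * B (r, θ)) θ := by
      intro θ
      have h := ((hφ.differentiable (by norm_num)) (z + r * e θ)).hasFDerivAt.comp_hasDerivAt θ
        (hne θ)
      refine h.congr_deriv ?_
      rw [map_smul, hB, Complex.real_smul]
      field_simp
    have h1 : ∫ θ in (-Real.pi)..Real.pi, (r / Complex.I) * B (r, θ) = 0 := by
      rw [intervalIntegral.integral_eq_sub_of_hasDerivAt (fun θ _ => hd θ)]
      · have : e (-Real.pi) = e Real.pi := by simp [he, Complex.exp_neg]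
        rw [this, sub_self]
      · exact Continuous.intervalIntegrable (by fun_prop) _ _
    rw [intervalIntegral.integral_const_mul] at h1
    have h2 := (mul_eq_zero.1 h1).resolve_left (div_ne_zero hr0 Complex.I_ne_zero)
    rwa [intervalIntegral.integral_of_le (by linarith [Real.pi_pos]),
      integral_Ioc_eq_integral_Ioo] at h2
  calc ∫ ζ, (fderiv ℝ φ ζ 1 + Complex.I * fderiv ℝ φ ζ Complex.I) / (ζ - z)
      = ∫ ζ, (fderiv ℝ φ (z + ζ) 1 + Complex.I * fderiv ℝ φ (z + ζ) Complex.I) / ζ := by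
        rw [← integral_add_left_eq_self _ z]
        simp
    _ = ∫ p in Ioi (0 : ℝ) ×ˢ Ioo (-Real.pi) Real.pi, (A p + B p) := by
        rw [← Complex.integral_comp_polarCoord_symm, polarCoord_target]
        refine setIntegral_congr_fun (measurableSet_Ioi.prod measurableSet_Ioo) ?_
        rintro ⟨r, θ⟩ ⟨hr, -⟩
        have hr0 : (r : ℂ) ≠ 0 := by exact_mod_cast (mem_Ioi.1 hr).ne'
        have hs : Complex.polarCoord.symm (r, θ) = r * e θ := by
          rw [Complex.polarCoord_symm_apply, he]
          simp only [Complex.exp_mul_I, Complex.ofReal_cos, Complex.ofReal_sin]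
        have hθ : e θ ≠ 0 := Complex.exp_ne_zero _
        have h1 : e θ = Real.cos θ • (1 : ℂ) + Real.sin θ • Complex.I := by
          simp [he, Complex.exp_mul_I]
        have h2 : Complex.I * e θ = Real.cos θ • Complex.I - Real.sin θ • (1 : ℂ) := by
          rw [h1]; simp; linear_combination (Complex.sin θ) * Complex.I_mul_I
        have h3 : e θ * (Real.cos θ - Real.sin θ * Complex.I) = 1 := by
          have := Complex.cos_sq_add_sin_sq θ
          rw [h1]; simp
          linear_combination this - (Complex.sin θ) ^ 2 * Complex.I_mul_I
        simp only [hA, hB, hs]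
        set T := fderiv ℝ φ (z + r * e θ) with hT
        have h4 : T (e θ) = Real.cos θ * T 1 + Real.sin θ * T Complex.I := by
          rw [h1, map_add, map_smul, map_smul, Complex.real_smul, Complex.real_smul]
        have h5 : T (Complex.I * e θ) = Real.cos θ * T Complex.I - Real.sin θ * T 1 := by
          rw [h2, map_sub, map_smul, map_smul, Complex.real_smul, Complex.real_smul]
        rw [h4, h5, Complex.real_smul, div_eq_mul_inv, mul_inv, inv_eq_of_mul_eq_one_right h3]
        field_simp
        linear_combination (-(Real.sin θ : ℂ) * T Complex.I) * Complex.I_sq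
    _ = -(2 * Real.pi) * φ z := by
        rw [integral_add hAi hBi, hIA, hIB, add_zero]

/-! ### Runge approximation by averaging Cauchy kernels -/

/-- The integral of an integrable function with values in a closed subspace lies in it. -/
theorem integral_mem_of_isClosed {α E : Type*} [MeasurableSpace α] {μ : Measure α}
    [NormedAddCommGroup E] [NormedSpace ℂ E] [CompleteSpace E] (V : Submodule ℂ E)
    (hV : IsClosed (V : Set E)) {f : α → E} (hf : Integrable f μ) (hfV : ∀ a, f a ∈ V) :
    ∫ a, f a ∂μ ∈ V := by
  have := hV
  -- The quotient map by `V` is continuous and linear, so it commutes with the integral, and it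
  -- kills the integrand.
  rw [← Submodule.Quotient.mk_eq_zero, ← Submodule.mkQ_apply, ← Submodule.mkQL_apply,
    ← ContinuousLinearMap.integral_comp_comm V.mkQL hf]
  refine integral_eq_zero_of_ae (Eventually.of_forall fun a => ?_)
  simpa using (Submodule.Quotient.mk_eq_zero V).2 (hfV a)

/-- The functions on `X` that are restrictions of meromorphic functions with poles in `S` that are
bounded off the disc of radius `3 / 2` about `c`. -/
def meromorphicRestrictions (X S : Set ℂ) (c : ℂ) : Submodule ℂ C(X, ℂ) where
  carrier := {h | ∃ χ : ℂ → ℂ, MeromorphicOn χ univ ∧ (∀ z ∉ S, AnalyticAt ℂ χ z) ∧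
    (∃ B : ℝ, ∀ z ∉ ball c (3 / 2), ‖χ z‖ ≤ B) ∧ ∀ x : X, h x = χ x}
  zero_mem' := ⟨0, fun _ _ => analyticAt_const.meromorphicAt, fun _ _ => analyticAt_const,
    ⟨0, fun _ _ => by simp⟩, fun _ => rfl⟩
  add_mem' := by
    rintro h k ⟨χ, m, a, ⟨B, b⟩, e⟩ ⟨χ', m', a', ⟨B', b'⟩, e'⟩
    exact ⟨χ + χ', m.add m', fun z hz => (a z hz).add (a' z hz),
      ⟨B + B', fun z hz => (norm_add_le _ _).trans (add_le_add (b z hz) (b' z hz))⟩,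
      fun x => by simp [e, e']⟩
  smul_mem' := by
    rintro t h ⟨χ, m, a, ⟨B, b⟩, e⟩
    refine ⟨fun z => t * χ z, (MeromorphicOn.const t).mul m,
      fun z hz => analyticAt_const.mul (a z hz),
      ⟨‖t‖ * B, fun z hz => ?_⟩, fun x => by simp [e]⟩
    rw [norm_mul]
    exact mul_le_mul_of_nonneg_left (b z hz) (norm_nonneg _)

/-- A **Runge-type theorem**: disjoint compact sets `L`, `M`, the first one in a disc, can be separated by
a meromorphic function with poles in the disc that is close to `1` on `L` and to `0` on `M`. -/
theorem exists_meromorphic_separating {c : ℂ} {L M : Set ℂ} (hL : IsCompact L) (hM : IsCompact M)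
    (hLM : Disjoint L M) (hLc : L ⊆ ball c 1) {δ : ℝ} (hδ : 0 < δ) :
    ∃ χ : ℂ → ℂ, MeromorphicOn χ univ ∧ (∀ z ∈ L ∪ M, AnalyticAt ℂ χ z) ∧
      (∀ z ∉ ball c 1, AnalyticAt ℂ χ z) ∧ (∃ B : ℝ, ∀ z ∉ ball c (3 / 2), ‖χ z‖ ≤ B) ∧
      (∀ z ∈ L, ‖χ z - 1‖ ≤ δ) ∧ ∀ z ∈ M, ‖χ z‖ ≤ δ := by
  obtain ⟨f, hf0, hf1, -⟩ := exists_contMDiffMap_zero_one_nhds_of_isClosed (n := 1)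
    (modelWithCornersSelf ℝ ℂ) (s := M ∪ (ball c 1)ᶜ) (t := L)
    (hM.isClosed.union isOpen_ball.isClosed_compl) hL.isClosed
    (disjoint_union_left.2 ⟨hLM.symm, disjoint_left.2 fun z hz hz' => hz (hLc hz')⟩)
  rw [eventually_nhdsSet_iff_forall] at hf0 hf1
  have hfd : ContDiff ℝ 1 f := contMDiff_iff_contDiff.1 f.contMDiff
  set φ : ℂ → ℂ := fun z => (f z : ℂ) with hφ
  have hφd : ContDiff ℝ 1 φ := Complex.ofRealCLM.contDiff.comp hfd
  have hφc : HasCompactSupport φ := by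
    refine HasCompactSupport.of_support_subset_isCompact (isCompact_closedBall c 1) ?_
    intro z hz
    by_contra hne
    refine hz ?_
    have := (hf0 z (Or.inr fun h => hne (ball_subset_closedBall h))).self_of_nhds
    simp [hφ, this]
  set ψ : ℂ → ℂ := fun ζ => fderiv ℝ φ ζ 1 + Complex.I * fderiv ℝ φ ζ Complex.I with hψ
  have hD : Continuous (fderiv ℝ φ) := hφd.continuous_fderiv (by norm_num)
  have hψcont : Continuous ψ := by fun_prop
  have hψc : HasCompactSupport ψ := (hφc.fderiv ℝ).mono' (by
    intro z hz
    refine subset_tsupport _ fun h => hz ?_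
    simp [hψ, h])
  have hloc : ∀ z ∈ (L ∪ M) ∪ (ball c 1)ᶜ, ψ =ᶠ[𝓝 z] 0 := by
    have key : ∀ (z w : ℂ), φ =ᶠ[𝓝 z] (fun _ => w) → ψ =ᶠ[𝓝 z] 0 := by
      intro z w h
      filter_upwards [h.fderiv (𝕜 := ℝ)] with y hy
      simp [hψ, hy]
    rintro z ((hz | hz) | hz)
    · exact key z 1 ((hf1 z hz).mono fun y hy => by simp [hφ, hy])
    · exact key z 0 ((hf0 z (Or.inl hz)).mono fun y hy => by simp [hφ, hy])
    · exact key z 0 ((hf0 z (Or.inr hz)).mono fun y hy => by simp [hφ, hy])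
  set X : Set ℂ := L ∪ M with hX
  have hXc : IsCompact X := hL.union hM
  have : CompactSpace X := isCompact_iff_compactSpace.1 hXc
  set S : Set ℂ := {ζ | ψ ζ ≠ 0} with hS
  have hSX : ∀ z ∈ X ∪ (ball c 1)ᶜ, z ∉ S := fun z hz h => h (hloc z hz).self_of_nhds
  -- The kernel is singular only on the diagonal, and `ψ` vanishes near every point of `X`.
  have hjoint : Continuous fun p : ℂ × X => ψ p.1 / (p.1 - p.2) := by
    rw [continuous_iff_continuousAt]
    rintro ⟨ζ, x⟩
    rcases eq_or_ne ζ x with rfl | hne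
    · have h1 : (fun p : ℂ × X => ψ p.1 / (p.1 - p.2)) =ᶠ[𝓝 ((x : ℂ), x)] fun _ => 0 := by
        have h2 : Tendsto (fun p : ℂ × X => p.1) (𝓝 ((x : ℂ), x)) (𝓝 (x : ℂ)) :=
          continuous_fst.tendsto ((x : ℂ), x)
        filter_upwards [h2.eventually (hloc x (Or.inl x.2))] with p hp
        simp only [hp, Pi.zero_apply, zero_div]
      exact continuousAt_const.congr h1.symm
    · refine ContinuousAt.div (by fun_prop) (by fun_prop) (sub_ne_zero.2 hne)
  -- The Cauchy–Pompeiu integral is read as a Bochner integral in `C(X, ℂ)`. Each value of `Φ` lies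
  -- in `V`, so the integral is a uniform limit on `X` of elements of `V`.
  set Φ : ℂ → C(X, ℂ) := fun ζ => ContinuousMap.curry ⟨_, hjoint⟩ ζ with hΦ
  have hΦcont : Continuous Φ := (ContinuousMap.curry ⟨_, hjoint⟩).continuous
  have hΦc : HasCompactSupport Φ := hψc.mono' (by
    intro ζ hζ
    refine subset_tsupport _ fun h => hζ ?_
    ext x
    simp [hΦ, h])
  have hΦi : Integrable Φ := hΦcont.integrable_of_hasCompactSupport hΦc
  set V := meromorphicRestrictions X S c with hV
  have hΦV : ∀ ζ, Φ ζ ∈ V := by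
    intro ζ
    by_cases hζ : ψ ζ = 0
    · have : Φ ζ = 0 := by ext x; simp [hΦ, hζ]
      rw [this]
      exact V.zero_mem
    · have hζc : ζ ∈ ball c 1 := by
        by_contra h
        exact hSX ζ (Or.inr h) hζ
      refine ⟨fun z => ψ ζ / (ζ - z), fun z _ => ?_, fun z hz => ?_, ⟨‖ψ ζ‖ * 2, fun z hz => ?_⟩,
        fun x => rfl⟩
      · exact MeromorphicAt.div (MeromorphicAt.const _ _)
          ((MeromorphicAt.const _ _).sub (MeromorphicAt.id z))
      · refine analyticAt_const.div (analyticAt_const.sub analyticAt_id) (sub_ne_zero.2 ?_)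
        rintro rfl
        exact hz hζ
      · rw [norm_div, div_le_iff₀' (norm_pos_iff.2 (sub_ne_zero.2 ?_))]
        · have h1 : 1 / 2 ≤ ‖ζ - z‖ := by
            rw [mem_ball, not_lt] at hz
            rw [mem_ball] at hζc
            have := dist_triangle_left z c ζ
            rw [dist_eq_norm ζ z] at this
            linarith
          nlinarith [norm_nonneg (ψ ζ)]
        · rintro rfl
          exact hz (ball_subset_ball (by norm_num) hζc)
  have hmem : ∫ ζ, Φ ζ ∈ V.topologicalClosure :=
    integral_mem_of_isClosed _ V.isClosed_topologicalClosure hΦi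
      fun ζ => V.le_topologicalClosure (hΦV ζ)
  have hmem' : -(2 * Real.pi : ℂ)⁻¹ • ∫ ζ, Φ ζ ∈ closure (V : Set C(X, ℂ)) :=
    V.topologicalClosure.smul_mem _ hmem
  obtain ⟨h, ⟨χ, hχm, hχa, hχb, hχe⟩, hd⟩ := Metric.mem_closure_iff.1 hmem' δ hδ
  have hest : ∀ z ∈ X, ‖χ z - φ z‖ ≤ δ := by
    intro z hz
    have h1 := (ContinuousMap.dist_apply_le_dist (f := -(2 * Real.pi : ℂ)⁻¹ • ∫ ζ, Φ ζ) (g := h)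
      ⟨z, hz⟩).trans hd.le
    rw [dist_comm, dist_eq_norm, hχe, ContinuousMap.smul_apply, ContinuousMap.integral_apply hΦi]
      at h1
    have h2 : ∫ ζ, (Φ ζ) ⟨z, hz⟩ = -(2 * Real.pi) * φ z := integral_dbar_div_sub hφd hφc z
    rw [h2, smul_eq_mul, neg_mul (2 * (Real.pi : ℂ)), neg_mul_neg, inv_mul_cancel_left₀] at h1
    · exact h1
    · exact mul_ne_zero two_ne_zero (Complex.ofReal_ne_zero.2 Real.pi_ne_zero)
  refine ⟨χ, hχm, fun z hz => hχa z (hSX z (Or.inl hz)), fun z hz => hχa z (hSX z (Or.inr hz)),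
    hχb, fun z hz => ?_, fun z hz => ?_⟩
  · have h1 : φ z = 1 := by simp [hφ, (hf1 z hz).self_of_nhds]
    simpa [h1] using hest z (Or.inl hz)
  · have h1 : φ z = 0 := by simp [hφ, (hf0 z (Or.inl hz)).self_of_nhds]
    simpa [h1] using hest z (Or.inr hz)

/-! ### Building blocks -/

/-- For disjoint compact subsets `L`, `M` of a disc of radius `1` there is a meromorphic function
that is close to `z + 6` on `L`, close to `0` on `M`, and small off the disc of radius `3 / 2`. -/
theorem exists_meromorphic_block (c : ℂ) {L M : Set ℂ} (hL : IsCompact L) (hM : IsCompact M)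
    (hLM : Disjoint L M) (hLc : L ⊆ ball c 1) (hMc : M ⊆ ball c 1) {δ τ : ℝ} (hδ : 0 < δ)
    (hτ : 0 < τ) :
    ∃ r : ℂ → ℂ, MeromorphicOn r univ ∧
      (∀ z ∉ ball c (3 / 2), AnalyticAt ℂ r z ∧ ‖r z‖ * (1 + ‖z‖) ^ 2 ≤ τ) ∧
      (∀ z ∈ L, AnalyticAt ℂ r z ∧ ‖r z - (z + 6)‖ ≤ δ) ∧
      ∀ z ∈ M, AnalyticAt ℂ r z ∧ ‖r z‖ ≤ δ := by
  set A : ℝ := ‖c‖ + 8 with hA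
  have hA0 : 0 < A := by positivity
  obtain ⟨χ, hχm, hχa, hχo, ⟨B, hB⟩, hχL, hχM⟩ :=
    exists_meromorphic_separating hL hM hLM hLc (δ := δ / (4 * A)) (by positivity)
  obtain ⟨k, hk⟩ := exists_pow_lt_of_lt_one (y := (5 / 6 : ℝ))
    (show 0 < min (1 / 2) (min (δ / (4 * A)) (τ / (2 * (|B| + 1) * A ^ 3))) by positivity)
    (by norm_num)
  obtain ⟨hk1, hk2⟩ := lt_min_iff.1 hk
  obtain ⟨hk2, hk3⟩ := lt_min_iff.1 hk2
  rw [lt_div_iff₀ (by positivity)] at hk2 hk3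
  -- This one number bounds `(4/5)^k` inside the unit disc and is the inverse of `(6/5)^k`, which
  -- governs the growth outside.
  set q : ℝ := (5 / 6) ^ k with hq
  have hq0 : 0 < q := by positivity
  set w : ℂ → ℂ := fun z => (z - c) * (4 / 5) with hw
  have hwn : ∀ z, ‖w z‖ = dist z c * (4 / 5) := by
    intro z
    simp [hw, dist_eq_norm]
  -- Dividing by `v` damps the block: `v` is nearly 1 for `|z - c| < 1`, large for `|z - c| ≥ 3/2`,
  -- and vanishes only on `|z - c| = 5/4`. The three extra powers absorb the cubic growth of `(z +
  -- 6)(1 + |z|)²`.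
  set v : ℂ → ℂ := fun z => 1 + w z ^ (k + 3) with hv
  have hva : ∀ z, AnalyticAt ℂ v z := fun z => by fun_prop
  have hin : ∀ z ∈ ball c 1, ‖w z ^ (k + 3)‖ ≤ q := by
    intro z hz
    rw [norm_pow, hwn]
    rw [mem_ball] at hz
    calc (dist z c * (4 / 5)) ^ (k + 3) ≤ (4 / 5 : ℝ) ^ (k + 3) :=
          pow_le_pow_left₀ (by positivity) (by linarith) _
      _ ≤ (4 / 5 : ℝ) ^ k := pow_le_pow_of_le_one (by norm_num) (by norm_num) (by omega)
      _ ≤ q := pow_le_pow_left₀ (by norm_num) (by norm_num) _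
  have hvin : ∀ z ∈ ball c 1, 1 / 2 ≤ ‖v z‖ := by
    intro z hz
    have h1 := norm_sub_le_norm_add (1 : ℂ) (w z ^ (k + 3))
    rw [norm_one] at h1
    have := hin z hz
    simp only [hv]
    linarith
  have h6 : ∀ z ∈ ball c 1, ‖z + 6‖ ≤ A := by
    intro z hz
    rw [mem_ball, dist_eq_norm] at hz
    calc ‖z + 6‖ = ‖(z - c) + c + 6‖ := by ring_nf
      _ ≤ ‖z - c‖ + ‖c‖ + ‖(6 : ℂ)‖ := norm_add₃_le
      _ ≤ A := by
        have : ‖(6 : ℂ)‖ = 6 := by simp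
        linarith
  have hout : ∀ z ∉ ball c (3 / 2), 1 / 2 * ‖w z‖ ^ (k + 3) ≤ ‖v z‖ := by
    intro z hz
    rw [mem_ball, not_lt] at hz
    have h1 : 6 / 5 ≤ ‖w z‖ := by rw [hwn]; linarith
    have h2 : 2 ≤ ‖w z‖ ^ (k + 3) := by
      have h3 : (6 / 5 : ℝ) ^ k * q = 1 := by rw [hq, ← mul_pow]; norm_num
      have h4 : 2 ≤ (6 / 5 : ℝ) ^ k := by nlinarith [pow_pos (show (0 : ℝ) < 6 / 5 by norm_num) k]
      calc (2 : ℝ) ≤ (6 / 5) ^ k := h4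
        _ ≤ (6 / 5) ^ (k + 3) := pow_le_pow_right₀ (by norm_num) (by omega)
        _ ≤ _ := pow_le_pow_left₀ (by norm_num) h1 _
    have h5 := norm_sub_le_norm_add (w z ^ (k + 3)) (1 : ℂ)
    rw [norm_one, norm_pow] at h5
    simp only [hv]
    rw [add_comm (1 : ℂ)]
    linarith
  have hra : ∀ z, AnalyticAt ℂ χ z → v z ≠ 0 →
      AnalyticAt ℂ (fun z => χ z * (z + 6) / v z) z := fun z h1 h2 =>
    (h1.mul (analyticAt_id.add analyticAt_const)).div (hva z) h2
  refine ⟨fun z => χ z * (z + 6) / v z, fun z hz => ?_, fun z hz => ?_, fun z hz => ?_,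
    fun z hz => ?_⟩
  · exact ((hχm z hz).mul ((MeromorphicAt.id z).add (MeromorphicAt.const _ _))).div
      (hva z).meromorphicAt
  · have hz' := hz
    rw [mem_ball, not_lt] at hz'
    have h1 : 6 / 5 ≤ ‖w z‖ := by rw [hwn]; linarith
    have hw0 : 0 < ‖w z‖ := by linarith
    have hv0 : 0 < ‖v z‖ := lt_of_lt_of_le (by positivity) (hout z hz)
    refine ⟨hra z (hχo z fun h => hz (ball_subset_ball (by norm_num) h)) (norm_pos_iff.1 hv0), ?_⟩
    have hzn : ‖z‖ ≤ ‖c‖ + 5 / 4 * ‖w z‖ := by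
      have h2 := norm_add_le (z - c) c
      rw [sub_add_cancel, ← dist_eq_norm] at h2
      rw [hwn]; linarith
    have hz6 : ‖z + 6‖ ≤ A * ‖w z‖ := by
      have h2 := norm_add_le z 6
      have : ‖(6 : ℂ)‖ = 6 := by simp
      nlinarith [norm_nonneg c]
    have hz1 : 1 + ‖z‖ ≤ A * ‖w z‖ := by nlinarith [norm_nonneg c]
    have hχB : ‖χ z‖ ≤ |B| + 1 := (hB z hz).trans (by linarith [le_abs_self B])
    have h7 : 1 ≤ q * ‖w z‖ ^ k := by
      have h3 : (6 / 5 : ℝ) ^ k * q = 1 := by rw [hq, ← mul_pow]; norm_num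
      have h4 := pow_le_pow_left₀ (by norm_num) h1 k
      nlinarith
    rw [norm_div, norm_mul, div_mul_eq_mul_div, div_le_iff₀ hv0]
    calc ‖χ z‖ * ‖z + 6‖ * (1 + ‖z‖) ^ 2
        ≤ (|B| + 1) * (A * ‖w z‖) * (A * ‖w z‖) ^ 2 := by gcongr
      _ = (|B| + 1) * A ^ 3 * ‖w z‖ ^ 3 * 1 := by ring
      _ ≤ (|B| + 1) * A ^ 3 * ‖w z‖ ^ 3 * (q * ‖w z‖ ^ k) := by gcongr
      _ = (q * (2 * (|B| + 1) * A ^ 3)) * (1 / 2 * ‖w z‖ ^ (k + 3)) := by ring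
      _ ≤ τ * ‖v z‖ := by gcongr; exact hout z hz
  · have hzc := hLc hz
    have hv1 := hvin z hzc
    have hv0 : v z ≠ 0 := norm_pos_iff.1 (by linarith)
    refine ⟨hra z (hχa z (Or.inl hz)) hv0, ?_⟩
    have he : χ z * (z + 6) / v z - (z + 6) = (z + 6) * ((χ z - 1) - w z ^ (k + 3)) / v z := by
      rw [div_sub' hv0]
      congr 1
      simp only [hv]; ring
    rw [he, norm_div, norm_mul, div_le_iff₀ (by linarith)]
    calc ‖z + 6‖ * ‖χ z - 1 - w z ^ (k + 3)‖ ≤ A * (δ / (4 * A) + q) := by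
          gcongr
          · exact h6 z hzc
          · exact (norm_sub_le _ _).trans (add_le_add (hχL z hz) (hin z hzc))
      _ = δ / 4 + A * q := by field_simp
      _ ≤ δ * (1 / 2) := by nlinarith
      _ ≤ δ * ‖v z‖ := by gcongr
  · have hzc := hMc hz
    have hv1 := hvin z hzc
    have hv0 : v z ≠ 0 := norm_pos_iff.1 (by linarith)
    refine ⟨hra z (hχa z (Or.inr hz)) hv0, ?_⟩
    rw [norm_div, norm_mul, div_le_iff₀ (by linarith)]
    calc ‖χ z‖ * ‖z + 6‖ ≤ δ / (4 * A) * A := by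
          gcongr
          · exact hχM z hz
          · exact h6 z hzc
      _ = δ / 4 := by field_simp
      _ ≤ δ * ‖v z‖ := by nlinarith

/-! ### Recursive choice of the blocks -/

/-- A decreasing sequence of compact subsets of the disc of radius `1 - ρ` about `0`, each
disjoint from the boundary of its predecessor. -/
structure IsCompactNest (C : ℕ → Set ℂ) (ρ : ℝ) : Prop where
  pos : 0 < ρ
  le_one : ρ ≤ 1
  isCompact : ∀ n, IsCompact (C n)
  subset : ∀ n, C (n + 1) ⊆ C n
  disjoint_frontier : ∀ n, Disjoint (C (n + 1)) (frontier (C n))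
  norm_add_le : ∀ z ∈ C 0, ‖z‖ + ρ ≤ 1

theorem IsCompactNest.subset_zero {C : ℕ → Set ℂ} {ρ : ℝ} (h : IsCompactNest C ρ) (n : ℕ) :
    C n ⊆ C 0 :=
  antitone_nat_of_succ_le h.subset (Nat.zero_le n)

/-- `r` is close to `z + 6` near the image of `C (n + 1)` under the `n`-th iterate of `s`, and small
near the image of the boundary of `C n`. -/
def IsCloseBlock (C : ℕ → Set ℂ) (n : ℕ) (s r : ℂ → ℂ) (η : ℝ) : Prop :=
  (∀ z ∈ cthickening (2 * η) (s^[n] '' C (n + 1)),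
    z ∈ ball (3 * n : ℂ) 1 ∧ AnalyticAt ℂ r z ∧ ‖r z - (z + 6)‖ ≤ η / 64) ∧
  ∀ z ∈ cthickening η (s^[n] '' frontier (C n)),
    z ∈ ball (3 * n : ℂ) 1 ∧ AnalyticAt ℂ r z ∧ ‖r z‖ ≤ 1 / 4

/-- `r` is meromorphic, and small off the disc of radius `3 / 2` about `3 n`. -/
def IsSmallBlock (n : ℕ) (r : ℂ → ℂ) (η : ℝ) : Prop :=
  MeromorphicOn r univ ∧ ∀ z ∉ ball (3 * n : ℂ) (3 / 2),
    AnalyticAt ℂ r z ∧ ‖r z‖ * (1 + ‖z‖) ^ 2 ≤ η / (64 * 4 ^ n)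

/-- Injectivity keeps the images of `C (n + 1)` and of the boundary of `C n` disjoint, and
compactness leaves room to thicken both inside the disc. Closeness is only conditional (the zero
block serves otherwise), so that the recursion can be run before anything is known about the
iterates. -/
theorem exists_block {C : ℕ → Set ℂ} {ρ : ℝ} (hC : IsCompactNest C ρ) (n : ℕ) (s : ℂ → ℂ)
    {θ : ℝ} (hθ : 0 < θ) :
    ∃ (r : ℂ → ℂ) (η : ℝ), 0 < η ∧ η ≤ θ ∧ IsSmallBlock n r η ∧
      (ContinuousOn s^[n] (C n) → InjOn s^[n] (C n) → MapsTo s^[n] (C n) (ball (3 * n : ℂ) 1) →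
        IsCloseBlock C n s r η) := by
  by_cases h : ContinuousOn s^[n] (C n) ∧ InjOn s^[n] (C n) ∧
      MapsTo s^[n] (C n) (ball (3 * n : ℂ) 1)
  swap
  · refine ⟨0, θ, hθ, le_rfl, ⟨fun _ _ => analyticAt_const.meromorphicAt, fun z _ =>
      ⟨analyticAt_const, ?_⟩⟩, fun h1 h2 h3 => absurd ⟨h1, h2, h3⟩ h⟩
    simp only [Pi.zero_apply, norm_zero, zero_mul]
    positivity
  obtain ⟨hc, hi, hm⟩ := h
  have hfr : frontier (C n) ⊆ C n := (hC.isCompact n).isClosed.frontier_subset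
  have hfc : IsCompact (frontier (C n)) :=
    (hC.isCompact n).of_isClosed_subset isClosed_frontier hfr
  set L := s^[n] '' C (n + 1) with hL
  set M := s^[n] '' frontier (C n) with hM
  have hLc : IsCompact L := (hC.isCompact (n + 1)).image_of_continuousOn (hc.mono (hC.subset n))
  have hMc : IsCompact M := hfc.image_of_continuousOn (hc.mono hfr)
  have hLM : Disjoint L M := by
    rw [hL, hM, disjoint_left]
    rintro _ ⟨x, hx, rfl⟩ ⟨y, hy, hxy⟩
    have := hi (hfr hy) (hC.subset n hx) hxy
    exact disjoint_left.1 (hC.disjoint_frontier n) hx (this ▸ hy)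
  have hLb : L ⊆ ball (3 * n : ℂ) 1 := (hm.mono_left (hC.subset n)).image_subset
  have hMb : M ⊆ ball (3 * n : ℂ) 1 := (hm.mono_left hfr).image_subset
  obtain ⟨a, ha, haLM⟩ := hLM.exists_cthickenings hLc hMc.isClosed
  obtain ⟨b, hb, hbL⟩ := hLc.exists_cthickening_subset_open isOpen_ball hLb
  obtain ⟨b', hb', hbM⟩ := hMc.exists_cthickening_subset_open isOpen_ball hMb
  set μ : ℝ := min (min a b) b' with hμ
  have hμ0 : 0 < μ := lt_min (lt_min ha hb) hb'
  -- Half of `μ` because one set is thickened by `2 * η`; at most 1 so that `η / 64 ≤ 1 / 4`.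
  set η : ℝ := min (min (μ / 2) θ) 1 with hη
  have hη0 : 0 < η := lt_min (lt_min (half_pos hμ0) hθ) one_pos
  have hημ : η ≤ μ / 2 := (min_le_left _ _).trans (min_le_left _ _)
  have h2 : 2 * η ≤ μ := by linarith
  have hμa : μ ≤ a := (min_le_left _ _).trans (min_le_left _ _)
  have hμb : μ ≤ b := (min_le_left _ _).trans (min_le_right _ _)
  have hμb' : μ ≤ b' := min_le_right _ _
  obtain ⟨r, hr1, hr2, hr3, hr4⟩ := exists_meromorphic_block (3 * n : ℂ)
    (hLc.cthickening (r := 2 * η)) (hMc.cthickening (r := η))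
    (haLM.mono (cthickening_mono (h2.trans hμa) _) (cthickening_mono (by linarith) _))
    ((cthickening_mono (h2.trans hμb) _).trans hbL)
    ((cthickening_mono (by linarith) _).trans hbM)
    (δ := η / 64) (τ := η / (64 * 4 ^ n)) (by positivity) (by positivity)
  refine ⟨r, η, hη0, (min_le_left _ _).trans (min_le_right _ _), ⟨hr1, hr2⟩, fun _ _ _ =>
    ⟨fun z hz => ⟨hbL (cthickening_mono (h2.trans hμb) _ hz), hr3 z hz⟩, fun z hz =>
      ⟨hbM (cthickening_mono (by linarith) _ hz), (hr4 z hz).1, (hr4 z hz).2.trans ?_⟩⟩⟩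
  have : η ≤ 1 := min_le_right _ _
  linarith

/-- The partial sums of the series `-3 + ∑ r k`. -/
def partialSum (r : ℕ → ℂ → ℂ) (n : ℕ) (z : ℂ) : ℂ := -3 + ∑ k ∈ Finset.range n, r k z

/-- A sequence of meromorphic functions such that the `n`-th one is adapted to the dynamics of the
sum of the previous ones. -/
structure IsBlockSequence (C : ℕ → Set ℂ) (ρ : ℝ) (r : ℕ → ℂ → ℂ) (η : ℕ → ℝ) : Prop where
  pos : ∀ n, 0 < η n
  succ_le : ∀ n, η (n + 1) ≤ η n
  le : ∀ n, η n ≤ ρ / 4 / (n + 1) ^ 2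
  small : ∀ n, IsSmallBlock n (r n) (η n)
  close : ∀ n, ContinuousOn (partialSum r n)^[n] (C n) → InjOn (partialSum r n)^[n] (C n) →
    MapsTo (partialSum r n)^[n] (C n) (ball (3 * n : ℂ) 1) →
      IsCloseBlock C n (partialSum r n) (r n) (η n)

/-- The recursion carries the pair of current partial sum and last margin, starting from `(-3, 1)`;
the next block depends on nothing else. -/
theorem exists_isBlockSequence {C : ℕ → Set ℂ} {ρ : ℝ} (hC : IsCompactNest C ρ) :
    ∃ r η, IsBlockSequence C ρ r η := by
  have hpos : ∀ (n : ℕ) (x : {x : ℝ // 0 < x}), 0 < min x.1 (ρ / 4 / (n + 1) ^ 2) := fun n x =>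
    lt_min x.2 (by have := hC.pos; positivity)
  choose R H h0 hle hsm hcl using fun (n : ℕ) (s : ℂ → ℂ) (x : {x : ℝ // 0 < x}) =>
    exists_block hC n s (hpos n x)
  let st : ℕ → (ℂ → ℂ) × {x : ℝ // 0 < x} := fun n =>
    Nat.rec (fun _ => -3, ⟨1, one_pos⟩)
      (fun n p => (fun z => p.1 z + R n p.1 p.2 z, ⟨H n p.1 p.2, h0 n p.1 p.2⟩)) n
  set r : ℕ → ℂ → ℂ := fun n => R n (st n).1 (st n).2 with hr
  have hs : ∀ n, partialSum r n = (st n).1 := by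
    intro n
    induction n with
    | zero => funext z; simp [partialSum, st]
    | succ n ih =>
      funext z
      have : partialSum r (n + 1) z = partialSum r n z + r n z := by
        simp [partialSum, Finset.sum_range_succ, add_assoc]
      rw [this, ih]
  refine ⟨r, fun n => H n (st n).1 (st n).2, fun n => h0 _ _ _, fun n => ?_, fun n => ?_,
    fun n => hsm _ _ _, fun n => ?_⟩
  · exact (hle (n + 1) _ _).trans (min_le_left _ _)
  · exact (hle n _ _).trans (min_le_right _ _)
  · rw [hs]
    exact hcl n _ _

/-! ### Estimates for the sums -/

/-- A form of the Schwarz lemma: bounded holomorphic functions are Lipschitz. -/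
theorem norm_sub_le_of_norm_le {v : ℂ → ℂ} {z w : ℂ} {B R : ℝ} (hR : 0 < R)
    (hd : DifferentiableOn ℂ v (ball z R)) (hB : ∀ y ∈ ball z R, ‖v y‖ ≤ B) (hw : ‖v w‖ ≤ B) :
    ‖v w - v z‖ ≤ 2 * B / R * ‖w - z‖ := by
  have hz : ‖v z‖ ≤ B := hB z (mem_ball_self hR)
  have h0 : ∀ y, ‖v y‖ ≤ B → ‖v y - v z‖ ≤ 2 * B := fun y hy =>
    (norm_sub_le _ _).trans (by linarith)
  by_cases h : w ∈ ball z R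
  · have := Complex.dist_le_div_mul_dist_of_mapsTo_ball hd (R₂ := 2 * B) (fun y hy => by
      rw [mem_closedBall, dist_eq_norm]
      exact h0 y (hB y hy)) h
    rwa [dist_eq_norm, dist_eq_norm] at this
  -- If `w` is outside the disc, then `|w - z| ≥ R` and the trivial bound `2 * B` suffices.
  · rw [mem_ball, not_lt, dist_eq_norm] at h
    refine (h0 w hw).trans ?_
    have hB0 : 0 ≤ B := (norm_nonneg _).trans hz
    rw [div_mul_eq_mul_div, le_div_iff₀ hR]
    gcongr

/-- Distinct centres are at least 3 apart. Hence at each point all blocks but at most one are small.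
-/
theorem notMem_ball_of_mem_ball {n k : ℕ} (h : k ≠ n) {z : ℂ}
    (hz : z ∈ ball (3 * n : ℂ) (3 / 2)) : z ∉ ball (3 * k : ℂ) (3 / 2) := by
  intro hk
  rw [mem_ball] at hz hk
  have h1 : dist (3 * n : ℂ) (3 * k) < 3 := by
    have := dist_triangle_left (3 * n : ℂ) (3 * k) z
    linarith
  have h2 : (3 * n : ℂ) - 3 * k = ((3 * ((n : ℤ) - k) : ℤ) : ℂ) := by push_cast; ring
  rw [dist_eq_norm, h2, Complex.norm_intCast] at h1
  have h3 : |3 * ((n : ℤ) - k)| < 3 := by exact_mod_cast h1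
  rw [abs_lt] at h3
  omega

namespace IsBlockSequence

variable {C : ℕ → Set ℂ} {ρ : ℝ} {r : ℕ → ℂ → ℂ} {η : ℕ → ℝ}

/-- As `η` decreases, this is a geometric sum of ratio 1/4, and `1/64 · 4/3 = 1/48`. -/
theorem sum_Ico_le (h : IsBlockSequence C ρ r η) {m M : ℕ} (hmM : m ≤ M) :
    ∑ k ∈ Finset.Ico m M, η k / (64 * 4 ^ k) ≤ η m / (48 * 4 ^ m) := by
  have hanti : Antitone η := antitone_nat_of_succ_le h.succ_le
  have key : ∑ k ∈ Finset.Ico m M, η k / (64 * 4 ^ k)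
      ≤ η m / 48 * ((4 ^ m)⁻¹ - (4 ^ M)⁻¹) := by
    induction M, hmM using Nat.le_induction with
    | base => simp
    | succ M hM ih =>
      rw [Finset.sum_Ico_succ_top hM]
      have h1 : η M / (64 * 4 ^ M) ≤ η m / (64 * 4 ^ M) := by
        gcongr
        exact hanti hM
      have h2 : η m / 48 * ((4 ^ m)⁻¹ - (4 ^ (M + 1))⁻¹)
          = η m / 48 * ((4 ^ m)⁻¹ - (4 ^ M)⁻¹) + η m / (64 * 4 ^ M) := by
        rw [pow_succ]
        field_simp
        ring
      linarith
  refine key.trans ?_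
  rw [div_mul_eq_div_div, div_eq_mul_inv (η m / 48)]
  have := h.pos m
  gcongr
  simp

theorem norm_le_of_notMem (h : IsBlockSequence C ρ r η) {k : ℕ} {z : ℂ}
    (hz : z ∉ ball (3 * k : ℂ) (3 / 2)) : ‖r k z‖ ≤ η k / (64 * 4 ^ k) := by
  refine le_trans (le_mul_of_one_le_right (norm_nonneg _) ?_) ((h.small k).2 z hz).2
  nlinarith [norm_nonneg z]

/-- Only blocks centred at other discs are added. The factor `2 ^ m` in the bound pays for the
doubling of errors over `m` iterations. -/
theorem norm_partialSum_sub_le (h : IsBlockSequence C ρ r η) {m M i : ℕ} (hmM : m ≤ M)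
    (hi : i < m) {z : ℂ} (hz : z ∈ ball (3 * i : ℂ) (3 / 2)) :
    ‖partialSum r M z - partialSum r m z‖ ≤ η m / (32 * 2 ^ m) := by
  have h1 : partialSum r M z - partialSum r m z = ∑ k ∈ Finset.Ico m M, r k z := by
    rw [partialSum, partialSum, add_sub_add_left_eq_sub, Finset.sum_Ico_eq_sub _ hmM]
  rw [h1]
  refine (norm_sum_le_of_le _ fun k hk => h.norm_le_of_notMem
    (notMem_ball_of_mem_ball (n := i) ?_ hz)).trans ((h.sum_Ico_le hmM).trans ?_)
  · have := (Finset.mem_Ico.1 hk).1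
    omega
  · have := h.pos m
    gcongr
    · norm_num
    · norm_num

/-- Here `|z| ≥ n`, so the quadratic decay of the earlier blocks gives a bound that is summable over
`n`. -/
theorem norm_sum_range_le (h : IsBlockSequence C ρ r η) {n : ℕ} {z : ℂ}
    (hz : z ∈ ball (3 * n : ℂ) (3 / 2)) :
    ‖∑ k ∈ Finset.range n, r k z‖ ≤ ρ / 192 / (n + 1) ^ 2 := by
  have hn : (n : ℝ) ≤ ‖z‖ := by
    rcases Nat.eq_zero_or_pos n with rfl | hn
    · simp
    · have h1 : (1 : ℝ) ≤ n := by exact_mod_cast hn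
      rw [mem_ball, dist_eq_norm] at hz
      have h2 := norm_sub_norm_le (3 * n : ℂ) z
      rw [norm_sub_rev] at h2
      have h3 : ‖(3 * n : ℂ)‖ = 3 * n := by simp
      linarith
  have h1 : ∀ k ∈ Finset.range n, ‖r k z‖ ≤ η k / (64 * 4 ^ k) / (n + 1) ^ 2 := by
    intro k hk
    have h2 := ((h.small k).2 z (notMem_ball_of_mem_ball (Finset.mem_range.1 hk).ne hz)).2
    rw [le_div_iff₀ (by positivity)]
    exact (mul_le_mul_of_nonneg_left (pow_le_pow_left₀ (by positivity) (by linarith) 2)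
      (norm_nonneg _)).trans h2
  refine (norm_sum_le_of_le _ h1).trans ?_
  rw [← Finset.sum_div]
  gcongr
  rw [Finset.range_eq_Ico]
  refine (h.sum_Ico_le (Nat.zero_le n)).trans ?_
  have := h.le 0
  norm_num at this ⊢
  linarith

/-- `F` agrees with the partial sums, up to small errors, on the discs `D_0, …, D_{n - 1}`. -/
def IsLimitUpTo (C : ℕ → Set ℂ) (r : ℕ → ℂ → ℂ) (η : ℕ → ℝ) (F : ℂ → ℂ) (n : ℕ) : Prop :=
  (∀ m ≤ n, ∀ i < m, ∀ z ∈ ball (3 * i : ℂ) 1,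
    ‖F z - partialSum r m z‖ ≤ η m / (32 * 2 ^ m)) ∧
  ∀ i < n, ∀ z ∈ cthickening (2 * η i) ((partialSum r i)^[i] '' C (i + 1)), AnalyticAt ℂ F z

theorem IsLimitUpTo.mono {F : ℂ → ℂ} {m n : ℕ} (hF : IsLimitUpTo C r η F n) (hmn : m ≤ n) :
    IsLimitUpTo C r η F m :=
  ⟨fun k hk => hF.1 k (hk.trans hmn), fun i hi => hF.2 i (hi.trans_le hmn)⟩

theorem analyticAt_sum_range (h : IsBlockSequence C ρ r η) {n : ℕ} {z : ℂ}
    (hz : z ∈ ball (3 * n : ℂ) (3 / 2)) :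
    AnalyticAt ℂ (fun z => ∑ k ∈ Finset.range n, r k z) z :=
  Finset.analyticAt_fun_sum _ fun k hk =>
    ((h.small k).2 z (notMem_ball_of_mem_ball (Finset.mem_range.1 hk).ne hz)).1

theorem analyticAt_partialSum (h : IsBlockSequence C ρ r η) {M n : ℕ} {z : ℂ}
    (hz : z ∈ ball (3 * n : ℂ) (3 / 2)) (hn : AnalyticAt ℂ (r n) z) :
    AnalyticAt ℂ (partialSum r M) z := by
  refine analyticAt_const.add (Finset.analyticAt_fun_sum _ fun k _ => ?_)
  rcases eq_or_ne k n with rfl | hk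
  · exact hn
  · exact ((h.small k).2 z (notMem_ball_of_mem_ball hk hz)).1

theorem isLimitUpTo_partialSum (h : IsBlockSequence C ρ r η) {n : ℕ}
    (hG : ∀ i < n, IsCloseBlock C i (partialSum r i) (r i) (η i)) :
    IsLimitUpTo C r η (partialSum r n) n :=
  ⟨fun _ hm _ hi _ hz =>
    h.norm_partialSum_sub_le hm hi (ball_subset_ball (by norm_num) hz), fun i hi z hz =>
    h.analyticAt_partialSum (ball_subset_ball (by norm_num) ((hG i hi).1 z hz).1)
      ((hG i hi).1 z hz).2.1⟩

variable {F : ℂ → ℂ} {i : ℕ}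

/-- Near the image of `C (i + 1)` under the `i`-th iterate, `F` is close to a translation. -/
theorem norm_sub_translation_le (h : IsBlockSequence C ρ r η) (hρ : 0 < ρ) (hρ1 : ρ ≤ 1)
    (hF : IsLimitUpTo C r η F (i + 1)) (hG : IsCloseBlock C i (partialSum r i) (r i) (η i))
    {z : ℂ} (hz : z ∈ cthickening (η i) ((partialSum r i)^[i] '' C (i + 1))) :
    ‖F z - (z + 3)‖ ≤ ρ / 64 / (i + 1) ^ 2 ∧
    ∀ w ∈ cthickening (η i) ((partialSum r i)^[i] '' C (i + 1)),
      ‖F w - F z - (w - z)‖ ≤ 1 / 4 * ‖w - z‖ := by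
  set L := (partialSum r i)^[i] '' C (i + 1) with hL
  have hη := h.pos i
  have hsub : cthickening (η i) L ⊆ cthickening (2 * η i) L := cthickening_mono (by linarith) _
  set u : ℂ → ℂ := fun z => ∑ k ∈ Finset.range i, r k z with hu
  -- The error `F z - (z + 3)` is `u + v`: the earlier blocks `u` are small on the whole disc of
  -- radius 3/2, while `v` is controlled only on the thickening but by a multiple of `η i`.
  set v : ℂ → ℂ := fun z => F z - (z + 3) - u z with hv
  have hvb : ∀ y ∈ cthickening (2 * η i) L, ‖v y‖ ≤ η i / 32 := by
    intro y hy
    obtain ⟨hy1, -, hy2⟩ := hG.1 y hy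
    have h1 := hF.1 (i + 1) le_rfl i (Nat.lt_succ_self i) y hy1
    have h2 : v y = (F y - partialSum r (i + 1) y) + (r i y - (y + 6)) := by
      simp only [hv, hu, partialSum, Finset.sum_range_succ]
      ring
    have h3 : η (i + 1) / (32 * 2 ^ (i + 1)) ≤ η i / 64 := by
      have h4 : (1 : ℝ) ≤ 2 ^ i := one_le_pow₀ (by norm_num)
      apply div_le_div₀ hη.le (h.succ_le i) (by norm_num)
      rw [pow_succ]
      linarith
    rw [h2]
    exact (norm_add_le _ _).trans (by linarith)
  have hva : ∀ y ∈ cthickening (2 * η i) L, AnalyticAt ℂ v y := fun y hy =>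
    ((hF.2 i (Nat.lt_succ_self i) y hy).sub (analyticAt_id.add analyticAt_const)).sub
      (h.analyticAt_sum_range (ball_subset_ball (by norm_num) (hG.1 y hy).1))
  have hub := fun y hy => h.norm_sum_range_le (n := i) (z := y) hy
  have hFe : ∀ y, F y = y + 3 + u y + v y := fun y => by simp only [hv]; ring
  refine ⟨?_, fun w hw => ?_⟩
  · have h1 : F z - (z + 3) = u z + v z := by rw [hFe]; ring
    have h2 := hub z (ball_subset_ball (by norm_num) (hG.1 z (hsub hz)).1)
    have h3 := hvb z (hsub hz)
    have h4 := h.le i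
    have h5 : ρ / 64 / ((i : ℝ) + 1) ^ 2
        = ρ / 192 / (i + 1) ^ 2 + (4 / 3) * (ρ / 4 / (i + 1) ^ 2 / 32) := by ring
    rw [h1, h5]
    have h6 : 0 ≤ ρ / 4 / ((i : ℝ) + 1) ^ 2 := by positivity
    exact (norm_add_le _ _).trans (add_le_add h2 (by linarith))
  · have hbz : ball z (η i) ⊆ cthickening (2 * η i) L := by
      intro y hy
      have h1 : y ∈ cthickening (η i) (cthickening (η i) L) :=
        mem_cthickening_of_dist_le y z _ _ hz (mem_ball.1 hy).le
      rw [two_mul]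
      exact cthickening_cthickening_subset hη.le hη.le L h1
    have h1 := norm_sub_le_of_norm_le (v := v) (w := w) hη
      (fun y hy => (hva y (hbz hy)).differentiableAt.differentiableWithinAt)
      (fun y hy => hvb y (hbz hy)) (hvb w (hsub hw))
    have hbz' : ball z (1 / 2) ⊆ ball (3 * i : ℂ) (3 / 2) :=
      ball_subset_ball' (by have := mem_ball.1 (hG.1 z (hsub hz)).1; linarith)
    have hub' : ∀ y ∈ ball (3 * i : ℂ) (3 / 2), ‖u y‖ ≤ 1 / 192 := by
      intro y hy
      refine (hub y hy).trans (div_le_of_le_mul₀ (by positivity) (by norm_num) ?_)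
      have : (1 : ℝ) ≤ (i + 1) ^ 2 := one_le_pow₀ (by linarith [Nat.cast_nonneg (α := ℝ) i])
      linarith
    have h2 := norm_sub_le_of_norm_le (v := u) (w := w) (R := 1 / 2) (by norm_num)
      (fun y hy => (h.analyticAt_sum_range (hbz' hy)).differentiableAt.differentiableWithinAt)
      (fun y hy => hub' y (hbz' hy))
      (hub' w (ball_subset_ball (by norm_num) (hG.1 w (hsub hw)).1))
    have h3 : F w - F z - (w - z) = (u w - u z) + (v w - v z) := by
      rw [hFe w, hFe z]; ring
    have h4 : 2 * (η i / 32) / η i = 1 / 16 := by field_simp; norm_num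
    rw [h4] at h1
    rw [h3]
    refine (norm_add_le _ _).trans ?_
    have := norm_nonneg (w - z)
    norm_num at h2
    linarith

/-- Near the image of the boundary of `C i` under the `i`-th iterate, `F` is close to `-3`. -/
theorem norm_add_three_lt (h : IsBlockSequence C ρ r η) (hρ1 : ρ ≤ 1)
    (hF : IsLimitUpTo C r η F (i + 1)) (hG : IsCloseBlock C i (partialSum r i) (r i) (η i))
    {z : ℂ} (hz : z ∈ cthickening (η i) ((partialSum r i)^[i] '' frontier (C i))) :
    ‖F z + 3‖ < 1 := by
  obtain ⟨hz1, -, hz2⟩ := hG.2 z hz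
  have h1 := hF.1 (i + 1) le_rfl i (Nat.lt_succ_self i) z hz1
  have h2 := h.norm_sum_range_le (n := i) (ball_subset_ball (by norm_num) hz1)
  have h3 : F z + 3 = (F z - partialSum r (i + 1) z) + (∑ k ∈ Finset.range i, r k z) + r i z := by
    simp only [partialSum, Finset.sum_range_succ]
    ring
  have hi : (1 : ℝ) ≤ (i + 1) ^ 2 := one_le_pow₀ (by linarith [Nat.cast_nonneg (α := ℝ) i])
  have h4 : ρ / 192 / ((i : ℝ) + 1) ^ 2 ≤ 1 / 192 :=
    div_le_of_le_mul₀ (by positivity) (by norm_num) (by linarith)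
  have h5 : η (i + 1) / (32 * 2 ^ (i + 1)) ≤ 1 / 4 := by
    have h6 : η (i + 1) ≤ 1 := by
      refine (h.le (i + 1)).trans (div_le_of_le_mul₀ (by positivity) (by norm_num) ?_)
      have : (1 : ℝ) ≤ (((i + 1 : ℕ) : ℝ) + 1) ^ 2 :=
        one_le_pow₀ (by linarith [Nat.cast_nonneg (α := ℝ) (i + 1)])
      linarith
    refine div_le_of_le_mul₀ (by positivity) (by norm_num) ?_
    have : (1 : ℝ) ≤ 2 ^ (i + 1) := one_le_pow₀ (by norm_num)
    linarith
  rw [h3]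
  exact norm_add₃_le.trans_lt (by linarith)

/-! ### Induction on the iterates -/

/-- The properties of the `n`-th iterate of `F` on `C n`. -/
structure HasIterate (C : ℕ → Set ℂ) (ρ : ℝ) (r : ℕ → ℂ → ℂ) (η : ℕ → ℝ) (F : ℂ → ℂ) (n : ℕ) :
    Prop where
  continuousOn : ContinuousOn F^[n] (C n)
  injOn : InjOn F^[n] (C n)
  norm_sub_le : ∀ z ∈ C n, ‖F^[n] z - z - 3 * n‖ ≤ ρ * (1 - 1 / (n + 1))
  close : ∀ z ∈ C n, ‖F^[n] z - (partialSum r n)^[n] z‖ ≤ η n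

theorem HasIterate.mem_cthickening {n : ℕ} (hF : HasIterate C ρ r η F n) {S : Set ℂ} (hS : S ⊆ C n)
    {z : ℂ} (hz : z ∈ S) : F^[n] z ∈ cthickening (η n) ((partialSum r n)^[n] '' S) :=
  mem_cthickening_of_dist_le _ _ _ _ (mem_image_of_mem _ hz)
    (by rw [dist_eq_norm]; exact hF.close z (hS hz))

/-- The accumulated drift is strictly less than `ρ`, the distance that `C 0` keeps from the unit
circle. -/
theorem HasIterate.mapsTo (hC : IsCompactNest C ρ) {n : ℕ} (hF : HasIterate C ρ r η F n) :
    MapsTo F^[n] (C n) (ball (3 * n : ℂ) 1) := by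
  intro z hz
  have h1 := hF.norm_sub_le z hz
  have h2 := hC.norm_add_le z (hC.subset_zero n hz)
  have h3 : 0 < ρ * (1 / ((n : ℝ) + 1)) := by have := hC.pos; positivity
  rw [mem_ball, dist_eq_norm]
  calc ‖F^[n] z - 3 * n‖ = ‖(F^[n] z - z - 3 * n) + z‖ := by ring_nf
    _ ≤ ‖F^[n] z - z - 3 * n‖ + ‖z‖ := norm_add_le _ _
    _ < 1 := by linarith

/-- The strong induction is over all `F` at once, since comparing `F` with `partialSum r n` needs
the earlier cases for both. -/
theorem hasIterate (h : IsBlockSequence C ρ r η) (hC : IsCompactNest C ρ) {n : ℕ}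
    (hG : ∀ i < n, IsCloseBlock C i (partialSum r i) (r i) (η i)) :
    ∀ {F : ℂ → ℂ}, IsLimitUpTo C r η F n → HasIterate C ρ r η F n := by
  induction n using Nat.strong_induction_on with
  | _ n ih =>
    intro F hF
    rcases n with _ | n
    · exact ⟨continuousOn_id, injOn_id _, fun z _ => by simp, fun z _ => by simpa using (h.pos 0).le⟩
    have hs := h.isLimitUpTo_partialSum hG
    have hit : ∀ {F : ℂ → ℂ}, IsLimitUpTo C r η F (n + 1) → ∀ i ≤ n, HasIterate C ρ r η F i :=
      fun hF i hi => ih i (Nat.lt_succ_of_le hi) (fun j hj => hG j (by omega))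
        (hF.mono (by omega))
    have hmem : ∀ {F : ℂ → ℂ}, IsLimitUpTo C r η F (n + 1) → ∀ i ≤ n, ∀ z ∈ C (n + 1),
        F^[i] z ∈ cthickening (η i) ((partialSum r i)^[i] '' C (i + 1)) :=
      fun hF i hi z hz => (hit hF i hi).mem_cthickening (hC.subset i)
        (antitone_nat_of_succ_le hC.subset (Nat.succ_le_succ hi) hz)
    have htr : ∀ {F : ℂ → ℂ}, IsLimitUpTo C r η F (n + 1) → ∀ i ≤ n,
        ∀ z ∈ cthickening (η i) ((partialSum r i)^[i] '' C (i + 1)),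
        ‖F z - (z + 3)‖ ≤ ρ / 64 / (i + 1) ^ 2 ∧
        ∀ w ∈ cthickening (η i) ((partialSum r i)^[i] '' C (i + 1)),
          ‖F w - F z - (w - z)‖ ≤ 1 / 4 * ‖w - z‖ :=
      fun hF i hi z hz => h.norm_sub_translation_le hC.pos hC.le_one (hF.mono (by omega))
        (hG i (by omega)) hz
    have hIF := hit hF n le_rfl
    refine ⟨?_, ?_, fun z hz => ?_, fun z hz => ?_⟩
    · rw [Function.iterate_succ']
      refine ContinuousOn.comp (t := cthickening (2 * η n) ((partialSum r n)^[n] '' C (n + 1)))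
        (fun y hy => (hF.2 n (Nat.lt_succ_self n) y hy).continuousAt.continuousWithinAt)
        (hIF.continuousOn.mono (hC.subset n)) fun z hz =>
          cthickening_mono (by linarith [h.pos n]) _ (hmem hF n le_rfl z hz)
    · intro z hz w hw hzw
      rw [Function.iterate_succ_apply', Function.iterate_succ_apply'] at hzw
      refine hIF.injOn (hC.subset n hz) (hC.subset n hw) ?_
      have h1 := (htr hF n le_rfl _ (hmem hF n le_rfl z hz)).2 _ (hmem hF n le_rfl w hw)
      rw [hzw, sub_self, zero_sub, norm_neg] at h1
      -- Equal values of `F` would give `|w - z| ≤ |w - z| / 4` for the `n`-th images.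
      have h2 : ‖F^[n] w - F^[n] z‖ = 0 := by linarith [norm_nonneg (F^[n] w - F^[n] z)]
      exact (sub_eq_zero.1 (norm_eq_zero.1 h2)).symm
    · rw [Function.iterate_succ_apply']
      have h1 := (htr hF n le_rfl _ (hmem hF n le_rfl z hz)).1
      have h2 := hIF.norm_sub_le z (hC.subset n hz)
      have h3 : F (F^[n] z) - z - 3 * ((n + 1 : ℕ) : ℂ)
          = (F (F^[n] z) - (F^[n] z + 3)) + (F^[n] z - z - 3 * n) := by push_cast; ring
      rw [h3]
      refine (norm_add_le _ _).trans ((add_le_add h1 h2).trans ?_)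
      -- The drift of one step is dominated by a telescoping difference, which moves the bound from
      -- `n` to `n + 1`.
      have h4 : ρ / 64 / ((n : ℝ) + 1) ^ 2 ≤ ρ * (1 / ((n : ℝ) + 1) - 1 / (n + 1 + 1)) := by
        have hn := Nat.cast_nonneg (α := ℝ) n
        rw [div_sub_div _ _ (by positivity) (by positivity), div_div, ← mul_div_assoc,
          div_le_div_iff₀ (by positivity) (by positivity)]
        have := hC.pos
        have h5 : ρ * ((n + 1) * (n + 1 + 1)) ≤ ρ * (64 * ((n : ℝ) + 1) ^ 2) :=
          mul_le_mul_of_nonneg_left (by nlinarith) this.le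
        linarith
      push_cast
      linarith
    · set δ := η (n + 1) / (32 * 2 ^ (n + 1)) with hδ
      have hδ0 : 0 < δ := by have := h.pos (n + 1); positivity
      -- The error obeys `e (i + 1) ≤ δ + (5/4) * e i`, hence `e i ≤ (2 ^ i - 1) * δ`.
      have key : ∀ i ≤ n + 1, ‖F^[i] z - (partialSum r (n + 1))^[i] z‖ ≤ (2 ^ i - 1) * δ := by
        intro i hi
        induction i with
        | zero => simp
        | succ i ihi =>
          have h1 := ihi (by omega)
          rw [Function.iterate_succ_apply', Function.iterate_succ_apply']
          set a := F^[i] z with ha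
          set b := (partialSum r (n + 1))^[i] z with hb
          have hma : a ∈ cthickening (η i) ((partialSum r i)^[i] '' C (i + 1)) :=
            hmem hF i (by omega) z hz
          have hmb : b ∈ cthickening (η i) ((partialSum r i)^[i] '' C (i + 1)) :=
            hmem hs i (by omega) z hz
          have h2 := (htr hs i (by omega) b hmb).2 a hma
          have h3 := hF.1 (n + 1) le_rfl i (by omega) a
            ((hG i (by omega)).1 a (cthickening_mono (by linarith [h.pos i]) _ hma)).1
          have h4 : F a - partialSum r (n + 1) b = (F a - partialSum r (n + 1) a) +
              (partialSum r (n + 1) a - partialSum r (n + 1) b - (a - b)) + (a - b) := by ring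
          rw [h4]
          refine norm_add₃_le.trans ?_
          have h5 : (1 : ℝ) ≤ 2 ^ i := one_le_pow₀ (by norm_num)
          rw [pow_succ]
          nlinarith
      refine (key (n + 1) le_rfl).trans ?_
      have h5 : (0 : ℝ) < 2 ^ (n + 1) := by positivity
      have h6 : 2 ^ (n + 1) * δ = η (n + 1) / 32 := by rw [hδ]; field_simp
      nlinarith [h.pos (n + 1)]

/-- Closeness of the earlier blocks makes the `n`-th iterate of `partialSum r n` continuous and
injective with values in the right disc, which is the condition under which `r n` was chosen close.
-/
theorem isCloseBlock (h : IsBlockSequence C ρ r η) (hC : IsCompactNest C ρ) (n : ℕ) :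
    IsCloseBlock C n (partialSum r n) (r n) (η n) := by
  induction n using Nat.strong_induction_on with
  | _ n ih =>
    have := h.hasIterate hC ih (h.isLimitUpTo_partialSum ih)
    exact h.close n this.continuousOn this.injOn (this.mapsTo hC)

end IsBlockSequence

/-! ### Values in the sphere, and a criterion for transcendence -/

/-- A meromorphic function in the sense of Mathlib extends to a continuous function into the
Riemann sphere. -/
theorem exists_isMeromorphic {f : ℂ → ℂ} (hf : MeromorphicOn f univ) :
    ∃ F : ℂ → OnePoint ℂ, IsMeromorphic F ∧ ∀ z, AnalyticAt ℂ f z → F z = (f z : OnePoint ℂ) := by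
  classical
  -- In normal form, the points of non-analyticity are exactly the poles, so `∞` is assigned only
  -- there.
  set g := toMeromorphicNFOn f univ with hg
  have hgn : MeromorphicNFOn g univ := meromorphicNFOn_toMeromorphicNFOn f univ
  have hgm : ∀ z, MeromorphicAt g z := fun z => (hgn (mem_univ z)).meromorphicAt
  set F : ℂ → OnePoint ℂ := fun z => if AnalyticAt ℂ g z then (g z : OnePoint ℂ) else ∞ with hF
  have hFg : ∀ z, AnalyticAt ℂ g z → F z = (g z : OnePoint ℂ) := fun z hz => if_pos hz
  have hne : ∀ z, ∀ᶠ w in 𝓝[≠] z, F w = (g w : OnePoint ℂ) := fun z =>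
    (hgm z).eventually_analyticAt.mono hFg
  refine ⟨F, ⟨continuous_iff_continuousAt.2 fun z => ?_, fun z => ⟨g, hgm z, hne z⟩⟩,
    fun z hz => ?_⟩
  · by_cases hz : AnalyticAt ℂ g z
    · have h1 : F =ᶠ[𝓝 z] fun w => (g w : OnePoint ℂ) := hz.eventually_analyticAt.mono hFg
      exact (OnePoint.continuous_coe.continuousAt.comp hz.continuousAt).congr h1.symm
    · have hord : meromorphicOrderAt g z < 0 := by
        by_contra h
        exact hz ((hgn (mem_univ z)).meromorphicOrderAt_nonneg_iff_analyticAt.1 (not_lt.1 h))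
      have h1 := (tendsto_cobounded_iff_meromorphicOrderAt_neg (hgm z)).2 hord
      rw [Metric.cobounded_eq_cocompact] at h1
      have h2 : Tendsto (fun w : ℂ => (w : OnePoint ℂ)) (cocompact ℂ) (𝓝 ∞) := by
        rw [← coclosedCompact_eq_cocompact]
        exact OnePoint.tendsto_coe_infty
      rw [continuousAt_iff_punctured_nhds]
      have h3 : F z = ∞ := if_neg hz
      rw [h3]
      exact (h2.comp h1).congr' ((hne z).mono fun w hw => hw.symm)
  · have h1 : g =ᶠ[𝓝 z] f := by
      have h2 := toMeromorphicNFOn_eq_toMeromorphicNFAt_on_nhds hf (mem_univ z)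
      rwa [toMeromorphicNFAt_eq_self.2 hz.meromorphicNFAt] at h2
    rw [hFg z (hz.congr h1.symm), h1.self_of_nhds]

/-- A function that is bounded along some sequence tending to infinity and unbounded along
another one is not rational. -/
theorem not_isRational_of_seq {F : ℂ → OnePoint ℂ} {a b α β : ℕ → ℂ} {B : ℝ}
    (ha : Tendsto a atTop (Bornology.cobounded ℂ)) (hb : Tendsto b atTop (Bornology.cobounded ℂ))
    (hFa : ∀ n, F (a n) = (α n : OnePoint ℂ)) (hFb : ∀ n, F (b n) = (β n : OnePoint ℂ))
    (hα : ∀ n, ‖α n‖ ≤ B) (hβ : Tendsto β atTop (Bornology.cobounded ℂ)) : ¬ IsRational F := by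
  rintro ⟨p, q, hq, h⟩
  have hroot : ∀ᶠ z in Bornology.cobounded ℂ, q.eval z ≠ 0 :=
    Bornology.le_cofinite ℂ (Polynomial.eventually_cofinite_not_isRoot hq)
  have hval : ∀ z w : ℂ, F z = (w : OnePoint ℂ) → q.eval z ≠ 0 → p.eval z = w * q.eval z := by
    intro z w hzw hz
    have h1 := h z hz
    rw [hzw, OnePoint.coe_eq_coe] at h1
    rw [h1, div_mul_cancel₀ _ hz]
  have hB : 0 ≤ B := (norm_nonneg _).trans (hα 0)
  -- If `deg p ≤ deg q`, the quotient is bounded near infinity, against `β`; otherwise it tends to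
  -- infinity, against `α`.
  rcases le_or_gt p.degree q.degree with hd | hd
  · obtain ⟨c, hc⟩ := (Polynomial.isBigO_cobounded_of_degree_le hd).bound
    have h2 := tendsto_norm_cobounded_atTop.comp hβ
    obtain ⟨n, h1, h3, h4⟩ := ((hb.eventually hc).and ((hb.eventually hroot).and
      (h2.eventually_gt_atTop c))).exists
    rw [hval _ _ (hFb n) h3, norm_mul] at h1
    exact absurd (le_of_mul_le_mul_right h1 (norm_pos_iff.2 h3)) (not_le.2 h4)
  · have hc := (Polynomial.isLittleO_cobounded_of_degree_lt hd).bound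
      (show 0 < 1 / (B + 1) by positivity)
    obtain ⟨n, h1, h3⟩ := ((ha.eventually hc).and (ha.eventually hroot)).exists
    rw [hval _ _ (hFa n) h3, norm_mul] at h1
    have h4 := norm_pos_iff.2 h3
    have h5 : 1 / (B + 1) * (‖α n‖ * ‖q.eval (a n)‖) ≤ 1 / (B + 1) * (B * ‖q.eval (a n)‖) := by
      gcongr
      exact hα n
    have h6 : 1 / (B + 1) * (B * ‖q.eval (a n)‖) < ‖q.eval (a n)‖ := by
      rw [one_div, inv_mul_lt_iff₀ (by positivity)]
      nlinarith
    linarith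

theorem iter_eq_iterate {F : ℂ → OnePoint ℂ} {f : ℂ → ℂ} {n : ℕ} {z : ℂ}
    (h : ∀ i < n, F (f^[i] z) = (f (f^[i] z) : OnePoint ℂ)) :
    iter F n z = (f^[n] z : OnePoint ℂ) := by
  induction n with
  | zero => rfl
  | succ n ih =>
    rw [iter, ih fun i hi => h i (by omega), OnePoint.elim_some, h n (Nat.lt_succ_self n),
      Function.iterate_succ_apply']

/-! ### The full series -/

namespace IsBlockSequence

variable {C : ℕ → Set ℂ} {ρ : ℝ} {r : ℕ → ℂ → ℂ} {η : ℕ → ℝ}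

theorem summable_bound (h : IsBlockSequence C ρ r η) :
    Summable fun k => η k / (64 * 4 ^ k) := by
  have hanti : Antitone η := antitone_nat_of_succ_le h.succ_le
  refine Summable.of_nonneg_of_le (fun k => ?_) (fun k => ?_)
    ((summable_geometric_of_lt_one (r := (1 / 4 : ℝ)) (by norm_num) (by norm_num)).mul_left
      (η 0 / 64))
  · have := h.pos k
    positivity
  · rw [one_div, inv_pow, ← div_eq_mul_inv, div_div]
    gcongr
    exact hanti (Nat.zero_le k)

theorem summable (h : IsBlockSequence C ρ r η) (z : ℂ) : Summable fun k => r k z := by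
  refine h.summable_bound.of_norm_bounded_eventually ?_
  by_cases hz : ∃ n : ℕ, z ∈ ball (3 * n : ℂ) (3 / 2)
  · obtain ⟨n, hn⟩ := hz
    filter_upwards [(finite_singleton n).compl_mem_cofinite] with k hk
    exact h.norm_le_of_notMem (notMem_ball_of_mem_ball hk hn)
  · exact Eventually.of_forall fun k => h.norm_le_of_notMem fun hk => hz ⟨k, hk⟩

theorem tendsto_partialSum (h : IsBlockSequence C ρ r η) (z : ℂ) :
    Tendsto (fun M => partialSum r M z) atTop (𝓝 (-3 + ∑' k, r k z)) :=
  (h.summable z).hasSum.tendsto_sum_nat.const_add (-3)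

theorem norm_tsum_lt (h : IsBlockSequence C ρ r η) (hρ1 : ρ ≤ 1) {z : ℂ}
    (hz : ∀ k : ℕ, z ∉ ball (3 * k : ℂ) (3 / 2)) : ‖∑' k, r k z‖ < 1 := by
  have h1 : ‖∑' k, r k z‖ ≤ η 0 / (48 * 4 ^ 0) := by
    refine le_of_tendsto (h.summable z).hasSum.tendsto_sum_nat.norm (Eventually.of_forall fun M => ?_)
    refine (norm_sum_le_of_le _ fun k _ => h.norm_le_of_notMem (hz k)).trans ?_
    rw [Finset.range_eq_Ico]
    exact h.sum_Ico_le (Nat.zero_le M)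
  have h2 := h.le 0
  norm_num at h1 h2
  linarith

/-- Only finitely many of the discs meet the unit disc about `z`; the remaining blocks form a
uniformly convergent series of holomorphic functions there. -/
theorem exists_tsum_eq_add (h : IsBlockSequence C ρ r η) (z : ℂ) :
    ∃ (N : ℕ) (g : ℂ → ℂ), AnalyticAt ℂ g z ∧
      (fun w => -3 + ∑' k, r k w) = fun w => partialSum r N w + g w := by
  obtain ⟨N, hN⟩ := exists_nat_gt (‖z‖ + 3)
  refine ⟨N, fun w => ∑' k, r (k + N) w, ?_, ?_⟩
  · have hout : ∀ k : ℕ, ∀ w ∈ ball z 1, w ∉ ball (3 * (k + N : ℕ) : ℂ) (3 / 2) := by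
      intro k w hw hw'
      rw [mem_ball, dist_eq_norm] at hw hw'
      have h1 := norm_sub_norm_le (3 * (k + N : ℕ) : ℂ) w
      rw [norm_sub_rev] at h1
      have h2 := norm_sub_norm_le w z
      have h3 : ‖(3 * (k + N : ℕ) : ℂ)‖ = 3 * (k + N : ℕ) := by
        rw [norm_mul, Complex.norm_natCast]; simp
      rw [h3] at h1
      push_cast at h1 hw'
      have := Nat.cast_nonneg (α := ℝ) k
      linarith [norm_nonneg z]
    have hd := Complex.differentiableOn_tsum_of_summable_norm (F := fun k w => r (k + N) w)
      ((summable_nat_add_iff N).2 h.summable_bound) (U := ball z 1)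
      (fun k w hw => ((h.small (k + N)).2 w
        (hout k w hw)).1.differentiableAt.differentiableWithinAt)
      isOpen_ball (fun k w hw => h.norm_le_of_notMem (hout k w hw))
    exact hd.analyticAt (isOpen_ball.mem_nhds (mem_ball_self one_pos))
  · funext w
    rw [partialSum, add_assoc, (h.summable w).sum_add_tsum_nat_add N]

theorem meromorphicOn_tsum (h : IsBlockSequence C ρ r η) :
    MeromorphicOn (fun z => -3 + ∑' k, r k z) univ := by
  intro z _
  obtain ⟨N, g, hg, he⟩ := h.exists_tsum_eq_add z
  rw [he]
  exact ((MeromorphicAt.const _ _).add (MeromorphicAt.fun_sum fun k _ =>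
    (h.small k).1 z (mem_univ z))).add hg.meromorphicAt

theorem analyticAt_tsum (h : IsBlockSequence C ρ r η) {z : ℂ} (hz : ∀ k, AnalyticAt ℂ (r k) z) :
    AnalyticAt ℂ (fun z => -3 + ∑' k, r k z) z := by
  obtain ⟨N, g, hg, he⟩ := h.exists_tsum_eq_add z
  rw [he]
  exact (analyticAt_const.add (Finset.analyticAt_fun_sum _ fun k _ => hz k)).add hg

theorem analyticAt_tsum_of_mem_ball (h : IsBlockSequence C ρ r η) {n : ℕ} {z : ℂ}
    (hz : z ∈ ball (3 * n : ℂ) 1) (hn : AnalyticAt ℂ (r n) z) :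
    AnalyticAt ℂ (fun z => -3 + ∑' k, r k z) z := by
  refine h.analyticAt_tsum fun k => ?_
  rcases eq_or_ne k n with rfl | hk
  · exact hn
  · exact ((h.small k).2 z (notMem_ball_of_mem_ball hk (ball_subset_ball (by norm_num) hz))).1

theorem isLimitUpTo_tsum (h : IsBlockSequence C ρ r η) (hC : IsCompactNest C ρ) (n : ℕ) :
    IsLimitUpTo C r η (fun z => -3 + ∑' k, r k z) n := by
  refine ⟨fun m _ i hi z hz => ?_, fun i _ z hz => ?_⟩
  · refine le_of_tendsto ((h.tendsto_partialSum z).sub_const (partialSum r m z)).norm ?_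
    filter_upwards [eventually_ge_atTop m] with M hM
    exact h.norm_partialSum_sub_le hM hi (ball_subset_ball (by norm_num) hz)
  · obtain ⟨h1, h2, -⟩ := (h.isCloseBlock hC i).1 z hz
    exact h.analyticAt_tsum_of_mem_ball h1 h2

end IsBlockSequence

/-! ### The neighbourhoods of `K` and the conclusion -/

/-- With `d` the distance to the circle, points of `K` have modulus at most `1 - d` and `nbhd K 0`
adds `d / 2`, leaving the margin `d / 2`. The radii decrease strictly, so each set lies in the
interior of its predecessor. -/
theorem isCompactNest_nbhd {K : Set ℂ} (hK : IsCompact K) (hne : K.Nonempty)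
    (hKD : K ⊆ ball (0 : ℂ) 1) :
    IsCompactNest (nbhd K) (setDist K (frontier (ball (0 : ℂ) 1)) / 2) := by
  set d := setDist K (frontier (ball (0 : ℂ) 1)) with hd
  have hfr : frontier (ball (0 : ℂ) 1) = sphere 0 1 := frontier_ball 0 one_ne_zero
  have hle : ∀ x ∈ K, ‖x‖ + d ≤ 1 := by
    intro x hx
    obtain ⟨y, hy, hxy⟩ : ∃ y : ℂ, ‖y‖ = 1 ∧ x = ‖x‖ * y := by
      rcases eq_or_ne x 0 with rfl | h0
      · exact ⟨1, by simp, by simp⟩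
      · have h1 : (‖x‖ : ℂ) ≠ 0 := by simpa using h0
        exact ⟨x / ‖x‖, by simp [h0], by field_simp⟩
    have hx1 : ‖x‖ < 1 := by simpa using hKD hx
    have h2 : dist x y = 1 - ‖x‖ := by
      have h3 : x - y = ((‖x‖ - 1 : ℝ) : ℂ) * y := by
        push_cast
        rw [sub_mul, ← hxy, one_mul]
      rw [dist_eq_norm, h3, norm_mul, hy, mul_one, Complex.norm_real, Real.norm_eq_abs,
        abs_of_nonpos (by linarith)]
      ring
    have h4 : d ≤ dist x y := by
      refine csInf_le ⟨0, ?_⟩ ⟨x, hx, y, ?_, rfl⟩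
      · rintro _ ⟨a, -, b, -, rfl⟩
        exact dist_nonneg
      · rw [hfr]
        simpa using hy
    linarith
  have hd0 : 0 < d := by
    obtain ⟨x, hx, hmax⟩ := hK.exists_isMaxOn hne continuous_norm.continuousOn
    have hx1 : ‖x‖ < 1 := by simpa using hKD hx
    have h1 : 1 - ‖x‖ ≤ d := by
      refine le_csInf ?_ ?_
      · exact ⟨_, x, hx, 1, by rw [hfr]; simp, rfl⟩
      · rintro _ ⟨a, ha, b, hb, rfl⟩
        rw [hfr, mem_sphere_zero_iff_norm] at hb
        have h2 : ‖a‖ ≤ ‖x‖ := hmax ha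
        have h3 := norm_sub_norm_le b a
        rw [dist_comm, dist_eq_norm]
        linarith
    linarith
  obtain ⟨x0, hx0⟩ := hne
  have hlt : ∀ n : ℕ, (1 / 2 : ℝ) ^ (n + 1 + 1) * d < (1 / 2) ^ (n + 1) * d := by
    intro n
    rw [pow_succ _ (n + 1)]
    have : 0 < (1 / 2 : ℝ) ^ (n + 1) * d := by positivity
    linarith
  refine ⟨by positivity, ?_, fun n => hK.cthickening, fun n => cthickening_mono (hlt n).le K,
    fun n => ?_, fun z hz => ?_⟩
  · linarith [hle x0 hx0, norm_nonneg x0]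
  · have h1 : nbhd K (n + 1) ⊆ interior (nbhd K n) :=
      (cthickening_subset_thickening' (by positivity) (hlt n) K).trans
        (thickening_subset_interior_cthickening _ K)
    exact disjoint_interior_frontier.mono_left h1
  · rw [nbhd, hK.cthickening_eq_biUnion_closedBall (by positivity)] at hz
    obtain ⟨x, hx, hzx⟩ := mem_iUnion₂.1 hz
    rw [mem_closedBall, dist_eq_norm] at hzx
    have h1 := norm_sub_norm_le z x
    have h2 := hle x hx
    norm_num at hzx
    linarith

theorem disc_natCast (n : ℕ) : disc (n : ℤ) = ball (3 * n : ℂ) 1 := by simp [disc]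

theorem tendsto_cobounded_of_mem_ball {b : ℕ → ℂ} (hb : ∀ n : ℕ, b n ∈ ball (3 * n : ℂ) 2) :
    Tendsto b atTop (Bornology.cobounded ℂ) := by
  rw [← tendsto_norm_atTop_iff_cobounded]
  refine tendsto_atTop_mono (f := fun n : ℕ => (n : ℝ) - 2) (fun n => ?_)
    (tendsto_atTop_add_const_right _ _ tendsto_natCast_atTop_atTop)
  have h1 := hb n
  rw [mem_ball, dist_eq_norm] at h1
  have h2 := norm_sub_norm_le (3 * n : ℂ) (b n)
  rw [norm_sub_rev] at h2
  have h3 : ‖(3 * n : ℂ)‖ = 3 * n := by simp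
  have := Nat.cast_nonneg (α := ℝ) n
  linarith

theorem exists_of_nonempty {K : Set ℂ} (hK : IsCompact K) (hne : K.Nonempty)
    (hKD : K ⊆ ball (0 : ℂ) 1) :
    ∃ f : ℂ → OnePoint ℂ, IsTranscendentalMeromorphic f ∧
      MapsTo f (closure (disc (-1))) ((fun w : ℂ => (w : OnePoint ℂ)) '' disc (-1)) ∧
      (∀ j : ℕ, InjOn (iter f j) (nbhd K j) ∧
        MapsTo (iter f j) (nbhd K j) ((fun w : ℂ => (w : OnePoint ℂ)) '' disc (j : ℤ))) ∧
      ∀ j : ℕ, MapsTo (iter f (j + 1)) (frontier (nbhd K j))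
        ((fun w : ℂ => (w : OnePoint ℂ)) '' disc (-1)) := by
  have hC := isCompactNest_nbhd hK hne hKD
  set C := nbhd K with hCdef
  obtain ⟨r, η, h⟩ := exists_isBlockSequence hC
  set f : ℂ → ℂ := fun z => -3 + ∑' k, r k z with hf
  obtain ⟨F, hF, hFf⟩ := exists_isMeromorphic h.meromorphicOn_tsum
  have hG := h.isCloseBlock hC
  have hlim := h.isLimitUpTo_tsum hC
  have hit : ∀ n, IsBlockSequence.HasIterate C _ r η f n := fun n =>
    h.hasIterate hC (fun i _ => hG i) (hlim n)
  have hstep : ∀ i, ∀ z ∈ C (i + 1), F (f^[i] z) = (f (f^[i] z) : OnePoint ℂ) := fun i z hz =>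
    hFf _ ((hlim (i + 1)).2 i (Nat.lt_succ_self i) _ (cthickening_mono (by linarith [h.pos i]) _
      ((hit i).mem_cthickening (hC.subset i) hz)))
  have hiter : ∀ n, ∀ z ∈ C n, iter F n z = (f^[n] z : OnePoint ℂ) := fun n z hz =>
    iter_eq_iterate fun i hi => hstep i z
      (antitone_nat_of_succ_le hC.subset (Nat.succ_le_of_lt hi) hz)
  have hball : disc (-1) = ball (-3 : ℂ) 1 := by simp [disc]
  have hout : ∀ z : ℂ, (∀ k : ℕ, z ∉ ball (3 * k : ℂ) (3 / 2)) →
      F z = (f z : OnePoint ℂ) ∧ f z ∈ disc (-1) := by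
    intro z hz
    refine ⟨hFf z (h.analyticAt_tsum fun k => ((h.small k).2 z (hz k)).1), ?_⟩
    rw [hball, mem_ball, dist_eq_norm]
    simpa [hf] using h.norm_tsum_lt hC.le_one hz
  refine ⟨F, ⟨hF, ?_⟩, fun z hz => ?_, fun j => ⟨fun z hz w hw hzw => ?_, fun z hz => ?_⟩,
    fun j z hz => ?_⟩
  · obtain ⟨x, hx⟩ := hne
    have hxC : ∀ n, x ∈ C n := fun n => self_subset_cthickening K hx
    -- The point `3n + 3/2` lies outside all the open discs of radius 3/2, so `f` maps it into
    -- `D_{-1}`.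
    have ha : ∀ n k : ℕ, (3 * n + 3 / 2 : ℂ) ∉ ball (3 * k : ℂ) (3 / 2) := by
      intro n k hk
      rw [mem_ball, dist_eq_norm] at hk
      have h1 : (3 * n + 3 / 2 - 3 * k : ℂ) = ((3 * ((n : ℝ) - k) + 3 / 2 : ℝ) : ℂ) := by
        push_cast; ring
      rw [h1, Complex.norm_real, Real.norm_eq_abs, abs_lt] at hk
      have h2 : (n : ℝ) < k := by linarith
      have h3 : (k : ℝ) < n + 1 := by linarith
      norm_cast at h2 h3
      omega
    refine not_isRational_of_seq (a := fun n : ℕ => 3 * n + 3 / 2) (b := fun n => f^[n] x)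
      (α := fun n : ℕ => f (3 * n + 3 / 2)) (β := fun n => f^[n + 1] x) (B := 4)
      (tendsto_cobounded_of_mem_ball fun n => ?_)
      (tendsto_cobounded_of_mem_ball fun n =>
        ball_subset_ball (by norm_num) ((hit n).mapsTo hC (hxC n)))
      (fun n => (hout _ (ha n)).1) (fun n => ?_) (fun n => ?_) ?_
    · rw [mem_ball, dist_eq_norm, add_sub_cancel_left]
      norm_num
    · rw [Function.iterate_succ_apply']
      exact hstep n x (hxC (n + 1))
    · have h1 := (hout _ (ha n)).2
      rw [hball, mem_ball, dist_eq_norm] at h1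
      have h2 := norm_sub_norm_le (f (3 * n + 3 / 2)) (-3)
      have h3 : ‖(-3 : ℂ)‖ = 3 := by simp
      linarith
    · exact (tendsto_cobounded_of_mem_ball (b := fun n => f^[n] x) fun n =>
        ball_subset_ball (by norm_num) ((hit n).mapsTo hC (hxC n))).comp (tendsto_add_atTop_nat 1)
  · have hz' : z ∈ closedBall (-3 : ℂ) 1 := by
      rwa [hball, closure_ball _ one_ne_zero] at hz
    obtain ⟨h1, h2⟩ := hout z fun k hk => by
      rw [mem_closedBall] at hz'
      rw [mem_ball] at hk
      have h1 := dist_triangle_left (3 * k : ℂ) (-3) z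
      have h2 : dist (3 * k : ℂ) (-3) = 3 * k + 3 := by
        have : (3 * k : ℂ) - -3 = ((3 * k + 3 : ℕ) : ℂ) := by push_cast; ring
        rw [dist_eq_norm, this, Complex.norm_natCast]
        push_cast; rfl
      have := Nat.cast_nonneg (α := ℝ) k
      linarith
    exact ⟨f z, h2, h1.symm⟩
  · rw [hiter j z hz, hiter j w hw, OnePoint.coe_eq_coe] at hzw
    exact (hit j).injOn hz hw hzw
  · rw [disc_natCast]
    exact ⟨f^[j] z, (hit j).mapsTo hC hz, (hiter j z hz).symm⟩
  · have hfr : frontier (C j) ⊆ C j := (hC.isCompact j).isClosed.frontier_subset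
    have h1 := (hit j).mem_cthickening hfr hz
    obtain ⟨h2, h3, -⟩ := (hG j).2 _ h1
    have h4 := h.norm_add_three_lt hC.le_one (hlim (j + 1)) (hG j) h1
    refine ⟨f (f^[j] z), ?_, ?_⟩
    · rw [hball, mem_ball, dist_eq_norm, sub_neg_eq_add]
      exact h4
    · rw [iter, hiter j z (hfr hz), OnePoint.elim_some,
        hFf _ (h.analyticAt_tsum_of_mem_ball h2 h3)]

theorem nbhd_empty (j : ℕ) : nbhd ∅ j = ∅ := cthickening_empty _

end WanderingCompacta

theorem mainTheorem4 (K : Set ℂ) (hK : IsCompact K) (hKD : K ⊆ Metric.ball (0 : ℂ) 1) :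
    ∃ f : ℂ → OnePoint ℂ,
      WanderingCompacta.IsTranscendentalMeromorphic f ∧
      Set.MapsTo f (closure (WanderingCompacta.disc (-1)))
        ((fun w : ℂ => (w : OnePoint ℂ)) '' WanderingCompacta.disc (-1)) ∧
      (∀ j : ℕ,
        Set.InjOn (WanderingCompacta.iter f j) (WanderingCompacta.nbhd K j) ∧
        Set.MapsTo (WanderingCompacta.iter f j) (WanderingCompacta.nbhd K j)
          ((fun w : ℂ => (w : OnePoint ℂ)) '' WanderingCompacta.disc (j : ℤ))) ∧
      (∀ j : ℕ,
        Set.MapsTo (WanderingCompacta.iter f (j + 1)) (frontier (WanderingCompacta.nbhd K j))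
          ((fun w : ℂ => (w : OnePoint ℂ)) '' WanderingCompacta.disc (-1))) := by
  rcases K.eq_empty_or_nonempty with rfl | hne
  -- For empty `K` the last two properties are vacuous, so the function built for `{0}` serves.
  · obtain ⟨f, h1, h2, -⟩ := WanderingCompacta.exists_of_nonempty (isCompact_singleton (x := (0 : ℂ)))
      (singleton_nonempty 0) (by simp)
    refine ⟨f, h1, h2, fun j => ?_, fun j => ?_⟩
    · rw [WanderingCompacta.nbhd_empty]
      exact ⟨injOn_empty _, mapsTo_empty _ _⟩
    · rw [WanderingCompacta.nbhd_empty, frontier_empty]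
      exact mapsTo_empty _ _
  · exact WanderingCompacta.exists_of_nonempty hK hne hKD
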